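/- **Theorem (Colored matching decoder).** Let $\Gamma$ be a 2-colex: a connected cubic graph embedded on a closed orientable surface of genus $g$, with a proper coloring of its faces by $x,y,z$. An edge connecting $c$-colored faces is $c$-colored. Put a qubit on each vertex and consider Pauli errors modulo phases. Write $P_x=X$, $P_y=Y$, $P_z=Z$. The cubic subsystem color code has gauge group $\mathcal G$ generated by the link operators $K_e=P_c\otimes P_c$ on the two ends of each $c$-colored edge $e$. Its stabilizers are the face operators $B_f=\prod_{v\in f}P_{c,v}$ for the $c$-colored faces $f$, and the nonlocal operators $W_i=\prod_{e\in\sigma_i}K_e$, $1\le i\le 2g$, where the cycles $\sigma_1,\dots,\sigma_{2g}$ represent a basis of the $\mathbb Z_2$-homology of the surface. The syndrome of an error is the pair $(s,t)$ with $s_f\in\mathbb Z_2$ (resp. $t_i$) equal to $1$ iff the error anticommutes with $B_f$ (resp. $W_i$). The weight of an error is the number of qubits on which it acts nontrivially. Errors that differ by an element of $\mathcal G$ are called equivalent. A set $A$ of edges of the dual graph $\Gamma^*$ represents the error $\prod_{e\in A}P_{c(e)}$, where the letter of the color $c(e)$ of $e$ acts on either one of the two ends of $e$ in $\Gamma$ (both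 choices are equivalent). The decoder receives the syndrome $(s,t)$ of some error. It (1) finds a minimum-weight perfect matching of the complete graph on the vertices $u$ of $\Gamma^*$ with $s_u\ne0$, the pair $\{u,v\}$ having as weight the distance of $u$ and $v$ in $\Gamma^*$; (2) takes a shortest path in $\Gamma^*$ for each matched pair and lets $\hat E_{\mathrm m}$ be the error represented by these paths; (3) computes $t'_i=t_i\oplus(\text{syndrome of }\hat E_{\mathrm m}\text{ on }W_i)$ and returns $\hat E=\hat E_{\mathrm m}\prod_i\hat E_i^{t'_i}$, where $\hat E_i$ is a $Z$-type error that anticommutes with $W_i$ and commutes with all the other stabilizers above. Then: (a) The face syndrome of the error represented by an edge set $A$ of $\Gamma^*$ is nonzero exactly at the vertices of $\Gamma^*$ of odd degree in $A$, and every error of weight $w$ is equivalent to one represented by an edge set with at most $w$ edges. (b) The matching, the paths and the errors $\hat E_i$ that the decoder needs always exist. For all choices of them: (c) $\hat E_{\mathrm m}$ has face syndrome $s$; its weight is the cost of the matching; and it has minimum weight among all the errors with face syndrome $s$. The cost of the matching is also at most $|A|$ for each edge set $A$ of $\Gamma^*$ whose vertices of odd degree are exactly those with $s_u\neq 0$.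 (d) $\hat E$ has the whole syndrome $(s,t)$. Up to equivalence it is the minimum-weight error with syndrome $(s,t)$: it is equivalent to an error that has minimum weight among those with syndrome $(s,t)$, and indeed to every error with syndrome $(s,t)$. If $t'=0$, then $\hat E$ itself has minimum weight among the errors with syndrome $(s,t)$. -/

import Mathlib

/-- The three colours. -/
inductive Colour : Type
  | x
  | y
  | z

/-- Single-qubit Pauli operators modulo phases `±1, ±i`: the pair `(a, b)` is `X ^ a * Z ^ b`, and
multiplication of Pauli operators is addition of pairs. -/
abbrev Pauli : Type := ZMod 2 × ZMod 2

/-- The Pauli letter attached to a colour: `X`, `Y = i X Z`, `Z`. -/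
def Colour.pauli : Colour → Pauli
  | .x => (1, 0)
  | .y => (1, 1)
  | .z => (0, 1)

theorem apply_eq_of_sameCycle {D C : Type*} (f : Equiv.Perm D) (g : D → C)
    (h : ∀ d, g (f d) = g d) {d d' : D} (hd : f.SameCycle d d') : g d = g d' := by
  obtain ⟨i, rfl⟩ := hd
  have hz : ∀ (i : ℤ) (d : D), g ((f ^ i) d) = g d := by
    intro i
    induction i using Int.induction_on with
    | zero => intro d; simp
    | succ n ih =>
      intro d
      rw [zpow_add_one, Equiv.Perm.mul_apply, ih, h]
    | pred n ih =>
      intro d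
      rw [zpow_sub_one, Equiv.Perm.mul_apply, ih, ← h (f⁻¹ d)]
      simp
  exact (hz i d).symm

/-- A 2-colex: a connected cubic graph embedded on a closed oriented surface, with a proper
3-colouring of its faces.  The embedded graph is given by its rotation system on the set `D` of
darts (half-edges): `rot` sends a dart to the next dart in the cyclic order around its origin,
`opp` sends a dart to the dart running along the same edge in the opposite direction.
The faces are the orbits of `rot * opp`. -/
structure TwoColex (D : Type*) where
  rot : Equiv.Perm D
  opp : Equiv.Perm D
  /-- every vertex has degree three -/
  rot_rot_rot : ∀ d, rot (rot (rot d)) = d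
  rot_ne : ∀ d, rot d ≠ d
  opp_opp : ∀ d, opp (opp d) = d
  opp_ne : ∀ d, opp d ≠ d
  connected : ∀ d d' : D, ∃ g ∈ Subgroup.closure {rot, opp}, g d = d'
  /-- the colour of the face to which a dart belongs -/
  colour : D → Colour
  colour_face : ∀ d, colour (rot (opp d)) = colour d
  /-- the faces on the two sides of an edge have different colours -/
  colour_opp_ne : ∀ d, colour (opp d) ≠ colour d

namespace TwoColex

variable {D : Type*} (Γ : TwoColex D)

/-! ### Vertices, edges, faces, and their colours -/

/-- Vertices of `Γ` (they carry the qubits). -/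
def Vertex : Type _ := Quotient (Equiv.Perm.SameCycle.setoid Γ.rot)

/-- Edges of `Γ`; they are also the edges of the dual graph `Γ*`. -/
def Edge : Type _ := Quotient (Equiv.Perm.SameCycle.setoid Γ.opp)

/-- Faces of `Γ`; they are the vertices of the dual graph `Γ*`. -/
def Face : Type _ := Quotient (Equiv.Perm.SameCycle.setoid (Γ.rot * Γ.opp))

/-- The origin of a dart. -/
def vertexOf (d : D) : Γ.Vertex := Quotient.mk (Equiv.Perm.SameCycle.setoid Γ.rot) d

/-- The edge of a dart. -/
def edgeOf (d : D) : Γ.Edge := Quotient.mk (Equiv.Perm.SameCycle.setoid Γ.opp) d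

/-- The face having a given dart on its boundary walk. -/
def faceOf (d : D) : Γ.Face :=
  Quotient.mk (Equiv.Perm.SameCycle.setoid (Γ.rot * Γ.opp)) d

instance [Finite D] : Finite Γ.Vertex := inferInstanceAs (Finite (Quotient _))
instance [Finite D] : Finite Γ.Edge := inferInstanceAs (Finite (Quotient _))
instance [Finite D] : Finite Γ.Face := inferInstanceAs (Finite (Quotient _))

noncomputable instance [Finite D] : Fintype Γ.Vertex := Fintype.ofFinite _
noncomputable instance [Finite D] : Fintype Γ.Edge := Fintype.ofFinite _
noncomputable instance [Finite D] : Fintype Γ.Face := Fintype.ofFinite _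

noncomputable instance : DecidableEq Γ.Vertex := Classical.decEq _
noncomputable instance : DecidableEq Γ.Edge := Classical.decEq _
noncomputable instance : DecidableEq Γ.Face := Classical.decEq _

/-- The colour of a face. -/
def faceColour : Γ.Face → Colour :=
  Quotient.lift Γ.colour fun _ _ h =>
    apply_eq_of_sameCycle (Γ.rot * Γ.opp) Γ.colour Γ.colour_face h

theorem colour_rot (d : D) : Γ.colour (Γ.rot d) = Γ.colour (Γ.opp d) := by
  have h := Γ.colour_face (Γ.opp d)
  rwa [Γ.opp_opp] at h

theorem colour_rot_ne (d : D) : Γ.colour (Γ.rot d) ≠ Γ.colour d := by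
  rw [Γ.colour_rot]; exact Γ.colour_opp_ne d

theorem colour_rot_rot_opp (d : D) :
    Γ.colour (Γ.rot (Γ.rot (Γ.opp d))) = Γ.colour (Γ.rot (Γ.rot d)) := by
  have h1 := Γ.colour_rot_ne (Γ.opp d)
  have h2 := Γ.colour_rot_ne (Γ.rot (Γ.opp d))
  have h3 := Γ.colour_rot_ne (Γ.rot (Γ.rot (Γ.opp d)))
  have k1 := Γ.colour_rot_ne d
  have k2 := Γ.colour_rot_ne (Γ.rot d)
  have k3 := Γ.colour_rot_ne (Γ.rot (Γ.rot d))
  rw [Γ.rot_rot_rot] at h3 k3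
  rw [Γ.colour_face d] at h1 h2
  rw [Γ.colour_rot d] at k1 k2
  revert h1 h2 h3 k1 k2 k3
  generalize Γ.colour (Γ.rot (Γ.rot (Γ.opp d))) = a
  generalize Γ.colour (Γ.rot (Γ.rot d)) = b
  generalize Γ.colour (Γ.opp d) = c
  generalize Γ.colour d = e
  cases a <;> cases b <;> cases c <;> cases e <;> simp

/-- The colour of an edge: an edge that connects `c`-coloured faces is `c`-coloured.  (Around the
origin of a dart `d` lie the faces of `d` and `rot d`, which are the two sides of the edge, and the
face of `rot (rot d)`, which the edge meets only at this end.) -/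
def edgeColour : Γ.Edge → Colour :=
  Quotient.lift (fun d => Γ.colour (Γ.rot (Γ.rot d))) fun _ _ h =>
    apply_eq_of_sameCycle Γ.opp (fun d => Γ.colour (Γ.rot (Γ.rot d))) Γ.colour_rot_rot_opp h

/-- `v` is an end of the edge `e`. -/
def IsEnd (v : Γ.Vertex) (e : Γ.Edge) : Prop := ∃ d, Γ.vertexOf d = v ∧ Γ.edgeOf d = e

/-- `v` lies on the face `f`. -/
def OnFace (v : Γ.Vertex) (f : Γ.Face) : Prop := ∃ d, Γ.vertexOf d = v ∧ Γ.faceOf d = f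

/-- `e` lies on the boundary of the face `f`; equivalently, the vertex `f` of the dual graph is an
end of the dual edge `e`. -/
def Borders (e : Γ.Edge) (f : Γ.Face) : Prop := ∃ d, Γ.edgeOf d = e ∧ Γ.faceOf d = f

/-- The genus `g` of the surface, from `|V| - |E| + |F| = 2 - 2g`. -/
noncomputable def genus : ℕ :=
  ((2 - ((Nat.card Γ.Vertex : ℤ) - Nat.card Γ.Edge + Nat.card Γ.Face)) / 2).toNat

/-! ### The dual graph -/

/-- The dual edge `e` joins the faces `f` and `g`. -/
def DualLink (e : Γ.Edge) (f g : Γ.Face) : Prop :=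
  ∃ d, Γ.edgeOf d = e ∧ Γ.faceOf d = f ∧ Γ.faceOf (Γ.opp d) = g

/-- Walks in the dual graph from one face to another, as lists of dual edges. -/
inductive IsDualWalk : Γ.Face → List Γ.Edge → Γ.Face → Prop
  | nil (f : Γ.Face) : IsDualWalk f [] f
  | cons {e : Γ.Edge} {f g h : Γ.Face} {p : List Γ.Edge} :
      Γ.DualLink e f g → IsDualWalk g p h → IsDualWalk f (e :: p) h

theorem DualLink.symm {e : Γ.Edge} {f g : Γ.Face} (h : Γ.DualLink e f g) : Γ.DualLink e g f := by
  obtain ⟨d, rfl, rfl, rfl⟩ := h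
  refine ⟨Γ.opp d, Quotient.sound ?_, rfl, by rw [Γ.opp_opp]⟩
  exact ⟨1, by simp [Γ.opp_opp]⟩

theorem IsDualWalk.snoc {e : Γ.Edge} {f g h : Γ.Face} {p : List Γ.Edge}
    (hp : Γ.IsDualWalk f p g) (he : Γ.DualLink e g h) : Γ.IsDualWalk f (p ++ [e]) h := by
  induction hp with
  | nil f => exact .cons he (.nil _)
  | cons h1 _ ih => exact .cons h1 (ih he)

theorem IsDualWalk.reverse {f g : Γ.Face} {p : List Γ.Edge} (hp : Γ.IsDualWalk f p g) :
    Γ.IsDualWalk g p.reverse f := by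
  induction hp with
  | nil f => exact .nil f
  | cons h1 _ ih => simpa using ih.snoc Γ (h1.symm Γ)

/-- Distance in the dual graph: the number of edges of a shortest walk. -/
noncomputable def dualDist (f g : Γ.Face) : ℕ := sInf {n | ∃ p, Γ.IsDualWalk f p g ∧ p.length = n}

theorem dualDist_comm (f g : Γ.Face) : Γ.dualDist f g = Γ.dualDist g f := by
  have h : ∀ f g : Γ.Face, {n | ∃ p, Γ.IsDualWalk f p g ∧ p.length = n} ⊆
      {n | ∃ p, Γ.IsDualWalk g p f ∧ p.length = n} := by
    rintro f g n ⟨p, hp, rfl⟩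
    exact ⟨p.reverse, hp.reverse, by simp⟩
  unfold dualDist
  rw [(h f g).antisymm (h g f)]

/-- `p` is a shortest path from `f` to `g` in the dual graph. -/
def IsShortestPath (f : Γ.Face) (p : List Γ.Edge) (g : Γ.Face) : Prop :=
  Γ.IsDualWalk f p g ∧ p.length = Γ.dualDist f g

/-- The degree of a dual vertex with respect to a set of dual edges. -/
noncomputable def dualDegree (A : Finset Γ.Edge) (f : Γ.Face) : ℕ :=
  {e | e ∈ A ∧ Γ.Borders e f}.ncard

/-! ### Errors, the gauge group and the syndrome -/

/-- Pauli operators on the qubits, modulo phases; the product of operators is written `+`. -/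
abbrev Error : Type _ := Γ.Vertex → Pauli

/-- The weight of an error: the number of qubits on which it acts nontrivially. -/
noncomputable def weight (E : Γ.Error) : ℕ := {v | E v ≠ 0}.ncard

/-- The operator acting as `P` on the qubit `v` and trivially elsewhere. -/
noncomputable def single (v : Γ.Vertex) (P : Pauli) : Γ.Error := Pi.single v P

open Classical in
/-- The link operator `K_e = P_u P_v` of an edge `e = (u, v)`, where `P` is the Pauli letter of the
colour of `e`. -/
noncomputable def link (e : Γ.Edge) : Γ.Error :=
  fun v => if Γ.IsEnd v e then (Γ.edgeColour e).pauli else 0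

/-- The gauge group (modulo phases), generated by the link operators. -/
def gaugeGroup : AddSubgroup Γ.Error := AddSubgroup.closure (Set.range Γ.link)

/-- Two errors are equivalent if they differ by an element of the gauge group. -/
def GaugeEquiv (E E' : Γ.Error) : Prop := E - E' ∈ Γ.gaugeGroup

open Classical in
/-- The face stabilizer `B_f`, the product over the vertices of `f` of the Pauli letter of the
colour of `f`. -/
noncomputable def faceStab (f : Γ.Face) : Γ.Error :=
  fun v => if Γ.OnFace v f then (Γ.faceColour f).pauli else 0

section Finite

variable [Finite D]

/-- `0` if the two Pauli operators commute, and `1` if they anticommute. -/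
noncomputable def commutator (E E' : Γ.Error) : ZMod 2 :=
  ∑ v, ((E v).1 * (E' v).2 + (E v).2 * (E' v).1)

/-- The cycle operator: the product of the link operators over a set of edges, the set being given
by its indicator function. -/
noncomputable def cycleOp (c : Γ.Edge → ZMod 2) : Γ.Error := ∑ e, c e • Γ.link e

/-- The syndrome on the faces (the stabilizers of trivial homology). -/
noncomputable def faceSyndrome (E : Γ.Error) : Γ.Face → ZMod 2 :=
  fun f => Γ.commutator (Γ.faceStab f) E

/-- The syndrome on the nonlocal stabilizers, the cycle operators of the cycles `σ i`. -/
noncomputable def cycleSyndrome {ι : Type*} (σ : ι → Γ.Edge → ZMod 2) (E : Γ.Error) : ι → ZMod 2 :=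
  fun i => Γ.commutator (Γ.cycleOp (σ i)) E

open Classical in
/-- Cycles: (indicator functions of) sets of edges with even degree at each vertex. -/
noncomputable def cycleSpace : Submodule (ZMod 2) (Γ.Edge → ZMod 2) :=
  ⨅ v : Γ.Vertex, LinearMap.ker
    (∑ e : Γ.Edge, if Γ.IsEnd v e then LinearMap.proj e else 0 :
      (Γ.Edge → ZMod 2) →ₗ[ZMod 2] ZMod 2)

open Classical in
/-- The cycles of trivial homology: sums of boundaries of faces. -/
noncomputable def boundarySpace : Submodule (ZMod 2) (Γ.Edge → ZMod 2) :=
  Submodule.span (ZMod 2) (Set.range fun f : Γ.Face => fun e => if Γ.Borders e f then 1 else 0)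

/-- The cycles `σ i` represent a basis of the homology of the surface with coefficients in
`ZMod 2`. -/
structure IsHomologyBasis {ι : Type*} (σ : ι → Γ.Edge → ZMod 2) : Prop where
  isCycle : ∀ i, σ i ∈ Γ.cycleSpace
  linearIndependent : LinearIndependent (ZMod 2) fun i => Γ.boundarySpace.mkQ (σ i)
  span_eq : Submodule.span (ZMod 2) (Set.range σ) ⊔ Γ.boundarySpace = Γ.cycleSpace

/-- `q` selects for each edge one of its two ends. -/
def IsQubitChoice (q : Γ.Edge → Γ.Vertex) : Prop := ∀ e, Γ.IsEnd (q e) e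

/-- The single-qubit error of a dual edge `e` of colour `c`: the Pauli letter of `c` on the chosen
end of `e` (the other end gives a gauge-equivalent error). -/
noncomputable def edgeError (q : Γ.Edge → Γ.Vertex) (e : Γ.Edge) : Γ.Error :=
  Γ.single (q e) (Γ.edgeColour e).pauli

/-! ### The decoder -/

/-- The vertices of the dual graph with nonzero syndrome. -/
abbrev Defect (s : Γ.Face → ZMod 2) : Type _ := {f : Γ.Face // s f ≠ 0}

/-- The weight `d(u, v)` of the edge `{u, v}` of the complete graph on the defects. -/
noncomputable def pairDist (s : Γ.Face → ZMod 2) : Sym2 (Γ.Defect s) → ℕ :=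
  Sym2.lift ⟨fun u v => Γ.dualDist u v, fun u v => Γ.dualDist_comm u v⟩

noncomputable instance (s : Γ.Face → ZMod 2) (M : (⊤ : SimpleGraph (Γ.Defect s)).Subgraph) :
    Fintype M.edgeSet := Fintype.ofFinite _

/-- The cost of a matching. -/
noncomputable def cost {s : Γ.Face → ZMod 2} (M : (⊤ : SimpleGraph (Γ.Defect s)).Subgraph) : ℕ :=
  ∑ m : M.edgeSet, Γ.pairDist s m

/-- A run of the colored matching decoder on the input `(s, t)`, where `s` is the syndrome on the
faces and `t` is the syndrome on the nonlocal stabilizers of the cycles `σ i`.  The fields record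
the choices that the decoder makes. -/
structure DecoderRun {ι : Type*} (σ : ι → Γ.Edge → ZMod 2) (s : Γ.Face → ZMod 2)
    (t : ι → ZMod 2) where
  /-- a minimum-weight perfect matching of the complete graph on the defects -/
  matching : (⊤ : SimpleGraph (Γ.Defect s)).Subgraph
  isPerfect : matching.IsPerfectMatching
  isMinimum : ∀ M : (⊤ : SimpleGraph (Γ.Defect s)).Subgraph,
    M.IsPerfectMatching → Γ.cost matching ≤ Γ.cost M
  /-- a shortest path in the dual graph for each matched pair -/
  path : matching.edgeSet → List Γ.Edge
  isShortest : ∀ m, ∃ u v : Γ.Defect s, m.1 = s(u, v) ∧ Γ.IsShortestPath u (path m) v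
  /-- the qubits on which the errors of the edges of the paths are placed -/
  qubit : Γ.Edge → Γ.Vertex
  isQubitChoice : Γ.IsQubitChoice qubit
  /-- for each nonlocal stabilizer a `Z` error that commutes with all the stabilizers but it -/
  correction : ι → Γ.Error
  correction_isZ : ∀ i v, correction i v = 0 ∨ correction i v = Colour.z.pauli
  correction_face : ∀ i, Γ.faceSyndrome (correction i) = 0
  correction_self : ∀ i, Γ.cycleSyndrome σ (correction i) i = 1
  correction_other : ∀ i j, j ≠ i → Γ.cycleSyndrome σ (correction i) j = 0

namespace DecoderRun

variable {Γ} {ι : Type*} {σ : ι → Γ.Edge → ZMod 2} {s : Γ.Face → ZMod 2} {t : ι → ZMod 2}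

/-- The error corresponding to the paths of the matching. -/
noncomputable def matchingError (R : Γ.DecoderRun σ s t) : Γ.Error :=
  ∑ m, ((R.path m).map (Γ.edgeError R.qubit)).sum

/-- The updated syndrome on the nonlocal stabilizers. -/
noncomputable def residual (R : Γ.DecoderRun σ s t) : ι → ZMod 2 :=
  fun i => t i + Γ.cycleSyndrome σ R.matchingError i

/-- The error estimate returned by the decoder. -/
noncomputable def output [Fintype ι] (R : Γ.DecoderRun σ s t) : Γ.Error :=
  R.matchingError + ∑ i, R.residual i • R.correction i

end DecoderRun

end Finite

end TwoColex

/-! Everything reduces to chains of edges modulo 2. The three edges at a vertex carry three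
different letters, so at each vertex a cycle operator is trivial or is the letter of the one edge
missing from the cycle. Hence it anticommutes with the letter of an incident edge exactly when that
edge lies in the cycle (`symp_cycleOp`). Face stabilizers are cycle operators too
(`faceStab_eq_cycleOp`), so every syndrome bit of an edge set is its intersection parity with a
cycle; for face boundaries this is a degree parity in the dual graph.

Each nontrivial letter on a qubit belongs to one incident edge, which turns an error into an edge
set that is no larger (`exists_edgeSet_gaugeEquiv`). An edge set orthogonal to all cycles is a sum
of vertex stars, and stars are gauge because three different letters multiply to the identity. So an
error commuting with all cycle operators is gauge (`mem_gaugeGroup_of_commutatorForm`). As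
boundaries and the `σ i` span the cycles, the syndrome determines the gauge class.

Minimality is the T-join argument: the odd vertices of an edge set can be paired at a cost of at
most its size (`exists_involutive_odd_dualDegree`), so the optimal matching bounds from below the
weight of every error with the given face syndrome, while its paths realize the cost.

The `Z`-type corrections exist because a cycle avoiding all `z`-coloured edges is a boundary; by
duality, a functional on cycles that kills boundaries depends only on the coefficients at
`z`-coloured edges. -/

namespace TwoColex

/-! ### Pauli letters -/

/-- The symplectic form on single-qubit Pauli operators. -/
def symp (p q : Pauli) : ZMod 2 := p.1 * q.2 + p.2 * q.1

theorem eq_zero_or_exists_pauli (p : Pauli) : p = 0 ∨ ∃ c : Colour, c.pauli = p := by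
  rcases p with ⟨a, b⟩
  revert a b
  have h : ∀ a b : ZMod 2, ((a, b) : Pauli) = 0 ∨ Colour.x.pauli = (a, b) ∨
      Colour.y.pauli = (a, b) ∨ Colour.z.pauli = (a, b) := by decide
  intro a b
  rcases h a b with h | h | h | h
  exacts [.inl h, .inr ⟨_, h⟩, .inr ⟨_, h⟩, .inr ⟨_, h⟩]

theorem pauli_add_pauli {a b c : Colour} (hab : a ≠ b) (hbc : b ≠ c) (hca : c ≠ a) :
    a.pauli + b.pauli = c.pauli := by
  cases a <;> cases b <;> cases c <;> first | contradiction | decide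

theorem pauli_add_pauli_add_pauli {a b c : Colour} (hab : a ≠ b) (hbc : b ≠ c) (hca : c ≠ a) :
    a.pauli + b.pauli + c.pauli = 0 := by
  cases a <;> cases b <;> cases c <;> first | contradiction | decide

/-- Different letters anticommute, so the form equals `l + m`, which is `k` by `h`. -/
theorem symp_of_sum_eq_zero {a b c : Colour} (hab : a ≠ b) (hbc : b ≠ c) (hca : c ≠ a)
    {k l m : ZMod 2} (h : k + l + m = 0) :
    symp (k • a.pauli + l • b.pauli + m • c.pauli) a.pauli = k := by
  revert k l m
  cases a <;> cases b <;> cases c <;> first | contradiction | decide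

variable {D : Type*} (Γ : TwoColex D)

/-! ### Incidences -/

theorem vertexOf_rot (d : D) : Γ.vertexOf (Γ.rot d) = Γ.vertexOf d :=
  Quotient.sound (Equiv.Perm.SameCycle.symm ⟨1, by simp⟩)

theorem edgeOf_opp (d : D) : Γ.edgeOf (Γ.opp d) = Γ.edgeOf d :=
  Quotient.sound (Equiv.Perm.SameCycle.symm ⟨1, by simp⟩)

theorem faceOf_rot_opp (d : D) : Γ.faceOf (Γ.rot (Γ.opp d)) = Γ.faceOf d :=
  Quotient.sound (Equiv.Perm.SameCycle.symm ⟨1, by simp⟩)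

theorem faceOf_opp (d : D) : Γ.faceOf (Γ.opp d) = Γ.faceOf (Γ.rot d) := by
  rw [← Γ.faceOf_rot_opp (Γ.opp d), Γ.opp_opp]

theorem exists_vertexOf (v : Γ.Vertex) : ∃ d, Γ.vertexOf d = v := Quotient.exists_rep v

theorem exists_edgeOf (e : Γ.Edge) : ∃ d, Γ.edgeOf d = e := Quotient.exists_rep e

theorem exists_faceOf (f : Γ.Face) : ∃ d, Γ.faceOf d = f := Quotient.exists_rep f

theorem vertexOf_eq_iff {d d' : D} :
    Γ.vertexOf d' = Γ.vertexOf d ↔ d' = d ∨ d' = Γ.rot d ∨ d' = Γ.rot (Γ.rot d) := by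
  constructor
  · intro h
    obtain ⟨i, hi⟩ : Γ.rot.SameCycle d d' := (Quotient.exact h).symm
    have key : ∀ i : ℤ, (Γ.rot ^ i) d = d ∨ (Γ.rot ^ i) d = Γ.rot d ∨
        (Γ.rot ^ i) d = Γ.rot (Γ.rot d) := by
      intro i
      induction i using Int.induction_on with
      | zero => simp
      | succ n ih =>
        rw [add_comm, zpow_one_add, Equiv.Perm.mul_apply]
        rcases ih with h | h | h <;> rw [h] <;> simp [Γ.rot_rot_rot]
      | pred n ih =>
        have : ∀ x, Γ.rot⁻¹ x = Γ.rot (Γ.rot x) := fun x => by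
          rw [Equiv.Perm.inv_eq_iff_eq, Γ.rot_rot_rot]
        rw [sub_eq_neg_add, zpow_add, Equiv.Perm.mul_apply, zpow_neg_one, this]
        rcases ih with h | h | h <;> rw [h] <;> simp [Γ.rot_rot_rot]
    rw [← hi]
    exact key i
  · rintro (rfl | rfl | rfl) <;> simp [Γ.vertexOf_rot]

theorem edgeOf_eq_iff {d d' : D} : Γ.edgeOf d' = Γ.edgeOf d ↔ d' = d ∨ d' = Γ.opp d := by
  constructor
  · intro h
    obtain ⟨i, hi⟩ : Γ.opp.SameCycle d d' := (Quotient.exact h).symm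
    have key : ∀ i : ℤ, (Γ.opp ^ i) d = d ∨ (Γ.opp ^ i) d = Γ.opp d := by
      intro i
      induction i using Int.induction_on with
      | zero => simp
      | succ n ih =>
        rw [add_comm, zpow_one_add, Equiv.Perm.mul_apply]
        rcases ih with h | h <;> rw [h] <;> simp [Γ.opp_opp]
      | pred n ih =>
        have : ∀ x, Γ.opp⁻¹ x = Γ.opp x := fun x => by
          rw [Equiv.Perm.inv_eq_iff_eq, Γ.opp_opp]
        rw [sub_eq_neg_add, zpow_add, Equiv.Perm.mul_apply, zpow_neg_one, this]
        rcases ih with h | h <;> rw [h] <;> simp [Γ.opp_opp]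
    rw [← hi]
    exact key i
  · rintro (rfl | rfl) <;> simp [Γ.edgeOf_opp]

theorem isEnd_vertexOf_iff (d : D) (e : Γ.Edge) : Γ.IsEnd (Γ.vertexOf d) e ↔
    e = Γ.edgeOf d ∨ e = Γ.edgeOf (Γ.rot d) ∨ e = Γ.edgeOf (Γ.rot (Γ.rot d)) := by
  constructor
  · rintro ⟨d', h, rfl⟩
    rcases Γ.vertexOf_eq_iff.1 h with rfl | rfl | rfl <;> simp
  · rintro (rfl | rfl | rfl)
    exacts [⟨_, rfl, rfl⟩, ⟨_, Γ.vertexOf_rot _, rfl⟩,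
      ⟨_, (Γ.vertexOf_rot _).trans (Γ.vertexOf_rot _), rfl⟩]

theorem isEnd_edgeOf_iff (d : D) (v : Γ.Vertex) : Γ.IsEnd v (Γ.edgeOf d) ↔
    v = Γ.vertexOf d ∨ v = Γ.vertexOf (Γ.opp d) := by
  constructor
  · rintro ⟨d', rfl, h⟩
    rcases Γ.edgeOf_eq_iff.1 h with rfl | rfl <;> simp
  · rintro (rfl | rfl)
    exacts [⟨_, rfl, rfl⟩, ⟨_, rfl, Γ.edgeOf_opp _⟩]

theorem borders_edgeOf_iff (d : D) (f : Γ.Face) : Γ.Borders (Γ.edgeOf d) f ↔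
    f = Γ.faceOf d ∨ f = Γ.faceOf (Γ.opp d) := by
  constructor
  · rintro ⟨d', h, rfl⟩
    rcases Γ.edgeOf_eq_iff.1 h with rfl | rfl <;> simp
  · rintro (rfl | rfl)
    exacts [⟨_, rfl, rfl⟩, ⟨_, Γ.edgeOf_opp _, rfl⟩]

theorem onFace_vertexOf_iff (d : D) (f : Γ.Face) : Γ.OnFace (Γ.vertexOf d) f ↔
    f = Γ.faceOf d ∨ f = Γ.faceOf (Γ.rot d) ∨ f = Γ.faceOf (Γ.rot (Γ.rot d)) := by
  constructor
  · rintro ⟨d', h, rfl⟩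
    rcases Γ.vertexOf_eq_iff.1 h with rfl | rfl | rfl <;> simp
  · rintro (rfl | rfl | rfl)
    exacts [⟨_, rfl, rfl⟩, ⟨_, Γ.vertexOf_rot _, rfl⟩,
      ⟨_, (Γ.vertexOf_rot _).trans (Γ.vertexOf_rot _), rfl⟩]

theorem faceColour_faceOf (d : D) : Γ.faceColour (Γ.faceOf d) = Γ.colour d := rfl

theorem edgeColour_edgeOf (d : D) : Γ.edgeColour (Γ.edgeOf d) = Γ.colour (Γ.rot (Γ.rot d)) := rfl

theorem colour_rot_rot_ne (d : D) : Γ.colour (Γ.rot (Γ.rot d)) ≠ Γ.colour d := by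
  have := Γ.colour_rot_ne (Γ.rot (Γ.rot d))
  rw [Γ.rot_rot_rot] at this
  exact this.symm

theorem edgeOf_rot_ne (d : D) : Γ.edgeOf (Γ.rot d) ≠ Γ.edgeOf d := fun h => by
  have := congrArg Γ.edgeColour h
  rw [edgeColour_edgeOf, edgeColour_edgeOf, Γ.rot_rot_rot] at this
  exact Γ.colour_rot_rot_ne d this.symm

theorem edgeOf_rot_rot_ne (d : D) : Γ.edgeOf (Γ.rot (Γ.rot d)) ≠ Γ.edgeOf d := fun h => by
  have := Γ.edgeOf_rot_ne (Γ.rot (Γ.rot d))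
  rw [Γ.rot_rot_rot] at this
  exact this h.symm

theorem faceOf_rot_ne (d : D) : Γ.faceOf (Γ.rot d) ≠ Γ.faceOf d := fun h =>
  Γ.colour_rot_ne d (congrArg Γ.faceColour h)

theorem faceOf_rot_rot_ne (d : D) : Γ.faceOf (Γ.rot (Γ.rot d)) ≠ Γ.faceOf d := fun h =>
  Γ.colour_rot_rot_ne d (congrArg Γ.faceColour h)

theorem faceOf_opp_ne (d : D) : Γ.faceOf (Γ.opp d) ≠ Γ.faceOf d := fun h =>
  Γ.colour_opp_ne d (congrArg Γ.faceColour h)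

/-- A loop would identify two of the three edges at a vertex, but these have different colours.
Hence a link operator really acts on two qubits. -/
theorem vertexOf_opp_ne (d : D) : Γ.vertexOf (Γ.opp d) ≠ Γ.vertexOf d := fun h => by
  rcases Γ.vertexOf_eq_iff.1 h with h | h | h
  · exact Γ.opp_ne d h
  · exact Γ.edgeOf_rot_ne d (by rw [← h, Γ.edgeOf_opp])
  · exact Γ.edgeOf_rot_rot_ne d (by rw [← h, Γ.edgeOf_opp])

/-- The three faces around a vertex are pairwise adjacent, so all colours occur among them, and each
edge takes the colour of the face opposite to it. -/
theorem exists_isEnd_of_colour (v : Γ.Vertex) (c : Colour) :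
    ∃ e, Γ.IsEnd v e ∧ Γ.edgeColour e = c := by
  obtain ⟨d, rfl⟩ := Γ.exists_vertexOf v
  have h1 := Γ.colour_rot_ne d
  have h2 := Γ.colour_rot_ne (Γ.rot d)
  have h3 := Γ.colour_rot_rot_ne d
  have : c = Γ.colour d ∨ c = Γ.colour (Γ.rot d) ∨ c = Γ.colour (Γ.rot (Γ.rot d)) := by
    revert h1 h2 h3
    generalize Γ.colour (Γ.rot (Γ.rot d)) = b
    generalize Γ.colour (Γ.rot d) = b'
    generalize Γ.colour d = b''
    cases c <;> cases b <;> cases b' <;> cases b'' <;> simp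
  simp only [isEnd_vertexOf_iff]
  rcases this with rfl | rfl | rfl
  · exact ⟨Γ.edgeOf (Γ.rot d), by simp, by rw [edgeColour_edgeOf, Γ.rot_rot_rot]⟩
  · exact ⟨Γ.edgeOf (Γ.rot (Γ.rot d)), by simp, by rw [edgeColour_edgeOf, Γ.rot_rot_rot]⟩
  · exact ⟨Γ.edgeOf d, by simp, rfl⟩

theorem link_edgeOf (d : D) : Γ.link (Γ.edgeOf d) =
    Γ.single (Γ.vertexOf d) (Γ.edgeColour (Γ.edgeOf d)).pauli +
      Γ.single (Γ.vertexOf (Γ.opp d)) (Γ.edgeColour (Γ.edgeOf d)).pauli := by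
  funext v
  have := Γ.vertexOf_opp_ne d
  simp only [link, single, isEnd_edgeOf_iff, Pi.add_apply, Pi.single_apply]
  by_cases h : v = Γ.vertexOf d
  · subst h; simp [this.symm]
  · simp [h]

/-! ### Cycles and their operators -/

open Classical in
/-- The boundary of a face, as an indicator function. -/
noncomputable def bdry (f : Γ.Face) : Γ.Edge → ZMod 2 := fun e => if Γ.Borders e f then 1 else 0

open Classical in
theorem bdry_edgeOf (f : Γ.Face) (d : D) : Γ.bdry f (Γ.edgeOf d) =
    (if f = Γ.faceOf d then 1 else 0) + (if f = Γ.faceOf (Γ.opp d) then 1 else 0) := by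
  have := Γ.faceOf_opp_ne d
  simp only [bdry, borders_edgeOf_iff]
  by_cases h : f = Γ.faceOf d
  · subst h; simp [this.symm]
  · simp [h]

theorem bdry_mem_boundarySpace (f : Γ.Face) : Γ.bdry f ∈ Γ.boundarySpace :=
  Submodule.subset_span ⟨f, rfl⟩

variable [Finite D]

theorem sum_isEnd {M : Type*} [AddCommMonoid M] (d : D) (F : Γ.Edge → M)
    [DecidablePred (Γ.IsEnd (Γ.vertexOf d))] :
    (∑ e, if Γ.IsEnd (Γ.vertexOf d) e then F e else 0) =
      F (Γ.edgeOf d) + F (Γ.edgeOf (Γ.rot d)) + F (Γ.edgeOf (Γ.rot (Γ.rot d))) := by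
  have h1 := Γ.edgeOf_rot_ne d
  have h2 := Γ.edgeOf_rot_rot_ne d
  have h3 := Γ.edgeOf_rot_ne (Γ.rot d)
  rw [← Finset.sum_filter]
  have : Finset.univ.filter (Γ.IsEnd (Γ.vertexOf d)) =
      {Γ.edgeOf d, Γ.edgeOf (Γ.rot d), Γ.edgeOf (Γ.rot (Γ.rot d))} := by
    ext e; simp [isEnd_vertexOf_iff]
  rw [this, Finset.sum_insert (by simp [h1.symm, h2.symm]), Finset.sum_pair h3.symm, add_assoc]

theorem mem_cycleSpace_iff {c : Γ.Edge → ZMod 2} : c ∈ Γ.cycleSpace ↔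
    ∀ d, c (Γ.edgeOf d) + c (Γ.edgeOf (Γ.rot d)) + c (Γ.edgeOf (Γ.rot (Γ.rot d))) = 0 := by
  classical
  have key : ∀ d, (∑ e : Γ.Edge, if Γ.IsEnd (Γ.vertexOf d) e then LinearMap.proj e else 0 :
      (Γ.Edge → ZMod 2) →ₗ[ZMod 2] ZMod 2) c =
      c (Γ.edgeOf d) + c (Γ.edgeOf (Γ.rot d)) + c (Γ.edgeOf (Γ.rot (Γ.rot d))) := by
    intro d
    rw [Γ.sum_isEnd d]
    rfl
  simp only [cycleSpace, Submodule.mem_iInf, LinearMap.mem_ker]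
  constructor
  · intro h d
    rw [← key]; convert h (Γ.vertexOf d)
  · intro h v
    obtain ⟨d, rfl⟩ := Γ.exists_vertexOf v
    have := h d
    rw [← key] at this; convert this

/-- Each of the three faces around a vertex borders two of its three edges, so its indicator occurs
twice and cancels. -/
theorem bdry_mem_cycleSpace (f : Γ.Face) : Γ.bdry f ∈ Γ.cycleSpace := by
  rw [mem_cycleSpace_iff]
  intro d
  simp only [bdry_edgeOf, faceOf_opp, Γ.rot_rot_rot]
  generalize (if f = Γ.faceOf d then (1 : ZMod 2) else 0) = a
  generalize (if f = Γ.faceOf (Γ.rot d) then (1 : ZMod 2) else 0) = b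
  generalize (if f = Γ.faceOf (Γ.rot (Γ.rot d)) then (1 : ZMod 2) else 0) = c
  revert a b c; decide

theorem cycleOp_vertexOf (c : Γ.Edge → ZMod 2) (d : D) : Γ.cycleOp c (Γ.vertexOf d) =
    c (Γ.edgeOf d) • (Γ.colour (Γ.rot (Γ.rot d))).pauli +
      c (Γ.edgeOf (Γ.rot d)) • (Γ.colour d).pauli +
      c (Γ.edgeOf (Γ.rot (Γ.rot d))) • (Γ.colour (Γ.rot d)).pauli := by
  classical
  have := Γ.sum_isEnd d fun e => c e • (Γ.edgeColour e).pauli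
  simp only [edgeColour_edgeOf, Γ.rot_rot_rot] at this
  rw [← this, cycleOp, Finset.sum_apply]
  refine Finset.sum_congr rfl fun e _ => ?_
  rw [Pi.smul_apply, link]
  split_ifs <;> simp

/-- At a vertex of `f` the boundary uses the two edges whose colours differ from that of `f`, and
the product of their letters is the letter of `f`. Face and nonlocal stabilizers can then be treated
alike. -/
theorem faceStab_eq_cycleOp (f : Γ.Face) : Γ.faceStab f = Γ.cycleOp (Γ.bdry f) := by
  classical
  funext v
  by_cases h : Γ.OnFace v f
  · obtain ⟨d, rfl, rfl⟩ := id h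
    have h1 := Γ.faceOf_rot_ne d
    have h2 := Γ.faceOf_rot_rot_ne d
    rw [cycleOp_vertexOf]
    simp only [bdry_edgeOf, faceOf_opp, Γ.rot_rot_rot, faceStab, if_pos h, h1.symm, h2.symm,
      if_true, if_false, faceColour_faceOf, add_zero, zero_add, one_smul, zero_smul]
    exact (pauli_add_pauli (Γ.colour_rot_ne _) (Γ.colour_rot_ne _)
      (Γ.colour_rot_rot_ne _).symm).symm
  · obtain ⟨d, rfl⟩ := Γ.exists_vertexOf v
    have h' := h
    rw [onFace_vertexOf_iff] at h'
    push Not at h'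
    rw [cycleOp_vertexOf]
    simp [bdry_edgeOf, faceOf_opp, Γ.rot_rot_rot, faceStab, if_neg h, h'.1, h'.2.1, h'.2.2]

/-- For a cycle, the operators `P_c` on an end of a `c`-coloured edge detect its coefficient. -/
theorem symp_cycleOp {c : Γ.Edge → ZMod 2} (hc : c ∈ Γ.cycleSpace) {v : Γ.Vertex} {e : Γ.Edge}
    (h : Γ.IsEnd v e) : symp (Γ.cycleOp c v) (Γ.edgeColour e).pauli = c e := by
  obtain ⟨d, rfl, rfl⟩ := h
  rw [cycleOp_vertexOf, edgeColour_edgeOf]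
  exact symp_of_sum_eq_zero (Γ.colour_rot_rot_ne d) (Γ.colour_rot_ne d).symm
    (Γ.colour_rot_ne _).symm (Γ.mem_cycleSpace_iff.1 hc d)

/-- The commutator as a bilinear form. -/
noncomputable def commutatorForm : Γ.Error →ₗ[ZMod 2] Γ.Error →ₗ[ZMod 2] ZMod 2 :=
  LinearMap.mk₂ (ZMod 2) Γ.commutator
    (fun E E' F => by
      simp only [commutator, ← Finset.sum_add_distrib, Pi.add_apply, Prod.fst_add, Prod.snd_add]
      exact Finset.sum_congr rfl fun v _ => by ring)
    (fun k E F => by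
      simp only [commutator, Pi.smul_apply, Prod.smul_fst, Prod.smul_snd, smul_eq_mul,
        Finset.mul_sum]
      exact Finset.sum_congr rfl fun v _ => by ring)
    (fun E E' F => by
      simp only [commutator, ← Finset.sum_add_distrib, Pi.add_apply, Prod.fst_add, Prod.snd_add]
      exact Finset.sum_congr rfl fun v _ => by ring)
    (fun k E F => by
      simp only [commutator, Pi.smul_apply, Prod.smul_fst, Prod.smul_snd, smul_eq_mul,
        Finset.mul_sum]
      exact Finset.sum_congr rfl fun v _ => by ring)

theorem commutatorForm_apply (E E' : Γ.Error) : Γ.commutatorForm E E' = Γ.commutator E E' := rfl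

theorem commutator_single (E : Γ.Error) (v : Γ.Vertex) (P : Pauli) :
    Γ.commutator E (Γ.single v P) = symp (E v) P := by
  rw [commutator, Finset.sum_eq_single v]
  · simp [single, symp]
  · intro w _ hw
    simp [single, Pi.single_eq_of_ne hw]
  · simp

theorem faceSyndrome_apply (E : Γ.Error) (f : Γ.Face) :
    Γ.faceSyndrome E f = Γ.commutatorForm (Γ.cycleOp (Γ.bdry f)) E := by
  rw [faceSyndrome, faceStab_eq_cycleOp, commutatorForm_apply]

theorem cycleSyndrome_apply {ι : Type*} (σ : ι → Γ.Edge → ZMod 2) (E : Γ.Error) (i : ι) :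
    Γ.cycleSyndrome σ E i = Γ.commutatorForm (Γ.cycleOp (σ i)) E := rfl

/-- Both ends of the edge contribute its coefficient in the cycle. -/
theorem commutatorForm_cycleOp_link {c : Γ.Edge → ZMod 2} (hc : c ∈ Γ.cycleSpace) (e : Γ.Edge) :
    Γ.commutatorForm (Γ.cycleOp c) (Γ.link e) = 0 := by
  obtain ⟨d, rfl⟩ := Γ.exists_edgeOf e
  rw [link_edgeOf, map_add]
  simp only [commutatorForm_apply, commutator_single]
  rw [Γ.symp_cycleOp hc ((Γ.isEnd_edgeOf_iff _ _).2 (.inl rfl)),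
    Γ.symp_cycleOp hc ((Γ.isEnd_edgeOf_iff _ _).2 (.inr rfl)), CharTwo.add_self_eq_zero]

theorem commutatorForm_cycleOp_of_mem_gaugeGroup {c : Γ.Edge → ZMod 2} (hc : c ∈ Γ.cycleSpace)
    {E : Γ.Error} (hE : E ∈ Γ.gaugeGroup) : Γ.commutatorForm (Γ.cycleOp c) E = 0 := by
  have : Γ.gaugeGroup ≤ (Γ.commutatorForm (Γ.cycleOp c)).toAddMonoidHom.ker := by
    rw [gaugeGroup, AddSubgroup.closure_le]
    rintro _ ⟨e, rfl⟩
    exact Γ.commutatorForm_cycleOp_link hc e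
  exact this hE

theorem commutatorForm_cycleOp_edgeError {c : Γ.Edge → ZMod 2} (hc : c ∈ Γ.cycleSpace)
    {q : Γ.Edge → Γ.Vertex} (hq : Γ.IsQubitChoice q) (e : Γ.Edge) :
    Γ.commutatorForm (Γ.cycleOp c) (Γ.edgeError q e) = c e := by
  rw [edgeError, commutatorForm_apply, commutator_single, Γ.symp_cycleOp hc (hq e)]

end TwoColex

/-! ### Errors as edge chains; the gauge group as the commutant of the cycle operators -/

namespace TwoColex

variable {D : Type*} (Γ : TwoColex D)

theorem single_add (v : Γ.Vertex) (P Q : Pauli) :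
    Γ.single v (P + Q) = Γ.single v P + Γ.single v Q :=
  Pi.single_add (f := fun _ => Pauli) v P Q

/-- Moving the letter of an edge from one end to the other is a gauge transformation. -/
theorem single_sub_single_mem_gaugeGroup {v w : Γ.Vertex} {e : Γ.Edge} (hv : Γ.IsEnd v e)
    (hw : Γ.IsEnd w e) : Γ.single v (Γ.edgeColour e).pauli - Γ.single w (Γ.edgeColour e).pauli ∈
      Γ.gaugeGroup := by
  obtain ⟨d, rfl, rfl⟩ := hv
  rcases (Γ.isEnd_edgeOf_iff _ _).1 hw with rfl | rfl
  · simp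
  · rw [sub_eq_add_neg, ZModModule.neg_eq_self, ← link_edgeOf]
    exact AddSubgroup.subset_closure ⟨_, rfl⟩

theorem gaugeEquiv_iff {E E' : Γ.Error} : Γ.GaugeEquiv E E' ↔ E - E' ∈ Γ.gaugeGroup := Iff.rfl

theorem smul_mem_gaugeGroup (k : ZMod 2) {E : Γ.Error} (hE : E ∈ Γ.gaugeGroup) :
    k • E ∈ Γ.gaugeGroup := ZMod.smul_mem hE k

theorem exists_isQubitChoice : ∃ q, Γ.IsQubitChoice q := by
  have : ∀ e, ∃ v, Γ.IsEnd v e := fun e => by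
    obtain ⟨d, rfl⟩ := Γ.exists_edgeOf e
    exact ⟨_, d, rfl, rfl⟩
  choose q hq using this
  exact ⟨q, hq⟩

open Classical in
theorem sum_bdry (A : Finset Γ.Edge) (f : Γ.Face) :
    ∑ e ∈ A, Γ.bdry f e = (Γ.dualDegree A f : ZMod 2) := by
  simp only [bdry]
  rw [Finset.sum_boole, dualDegree]
  congr 1
  rw [← Set.ncard_coe_finset]
  congr 1
  ext e; simp

variable [Finite D]

/-- The error of a set of dual edges, given by its indicator function. -/
noncomputable def edgeSetError (q : Γ.Edge → Γ.Vertex) : (Γ.Edge → ZMod 2) →ₗ[ZMod 2] Γ.Error :=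
  Fintype.linearCombination (ZMod 2) (Γ.edgeError q)

theorem edgeSetError_apply (q : Γ.Edge → Γ.Vertex) (a : Γ.Edge → ZMod 2) :
    Γ.edgeSetError q a = ∑ e, a e • Γ.edgeError q e := rfl

open Classical in
theorem edgeSetError_indicator (q : Γ.Edge → Γ.Vertex) (A : Finset Γ.Edge) :
    Γ.edgeSetError q (fun e => if e ∈ A then 1 else 0) = ∑ e ∈ A, Γ.edgeError q e := by
  simp [edgeSetError_apply, ite_smul]

theorem edgeSetError_single (q : Γ.Edge → Γ.Vertex) (e : Γ.Edge) :
    Γ.edgeSetError q (Pi.single e 1) = Γ.edgeError q e := by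
  simp [edgeSetError]

theorem commutatorForm_cycleOp_edgeSetError {c : Γ.Edge → ZMod 2} (hc : c ∈ Γ.cycleSpace)
    {q : Γ.Edge → Γ.Vertex} (hq : Γ.IsQubitChoice q) (a : Γ.Edge → ZMod 2) :
    Γ.commutatorForm (Γ.cycleOp c) (Γ.edgeSetError q a) = ∑ e, a e * c e := by
  rw [edgeSetError_apply, map_sum]
  exact Finset.sum_congr rfl fun e _ => by
    rw [map_smul, Γ.commutatorForm_cycleOp_edgeError hc hq, smul_eq_mul]

theorem faceSyndrome_edgeError {q : Γ.Edge → Γ.Vertex} (hq : Γ.IsQubitChoice q) (e : Γ.Edge)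
    (f : Γ.Face) : Γ.faceSyndrome (Γ.edgeError q e) f = Γ.bdry f e := by
  rw [faceSyndrome_apply, Γ.commutatorForm_cycleOp_edgeError (Γ.bdry_mem_cycleSpace f) hq]

theorem faceSyndrome_sum_edgeError {q : Γ.Edge → Γ.Vertex} (hq : Γ.IsQubitChoice q)
    (A : Finset Γ.Edge) (f : Γ.Face) :
    Γ.faceSyndrome (∑ e ∈ A, Γ.edgeError q e) f = (Γ.dualDegree A f : ZMod 2) := by
  rw [faceSyndrome_apply, map_sum, ← sum_bdry]
  exact Finset.sum_congr rfl fun e _ => by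
    rw [← faceSyndrome_apply, Γ.faceSyndrome_edgeError hq]

theorem faceSyndrome_ne_zero_iff_odd_dualDegree {q : Γ.Edge → Γ.Vertex} (hq : Γ.IsQubitChoice q)
    (A : Finset Γ.Edge) (f : Γ.Face) :
    Γ.faceSyndrome (∑ e ∈ A, Γ.edgeError q e) f ≠ 0 ↔ Odd (Γ.dualDegree A f) := by
  rw [Γ.faceSyndrome_sum_edgeError hq, ZMod.natCast_ne_zero_iff_odd]

theorem exists_edgeSet_gaugeEquiv {q : Γ.Edge → Γ.Vertex} (hq : Γ.IsQubitChoice q) (E : Γ.Error) :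
    ∃ A : Finset Γ.Edge, A.card ≤ Γ.weight E ∧ Γ.GaugeEquiv (∑ e ∈ A, Γ.edgeError q e) E := by
  classical
  have hv : ∀ v, ∃ e, E v ≠ 0 → Γ.IsEnd v e ∧ (Γ.edgeColour e).pauli = E v := by
    intro v
    rcases eq_zero_or_exists_pauli (E v) with h | ⟨c, hc⟩
    · obtain ⟨d, rfl⟩ := Γ.exists_vertexOf v
      exact ⟨Γ.edgeOf d, fun h' => absurd h h'⟩
    · obtain ⟨e, he, rfl⟩ := Γ.exists_isEnd_of_colour v c
      exact ⟨e, fun _ => ⟨he, hc⟩⟩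
  choose ε hε using hv
  let S : Finset Γ.Vertex := Finset.univ.filter fun v => E v ≠ 0
  -- The sum is modulo 2: an edge selected from both of its ends cancels, which only shrinks the
  -- set.
  let a : Γ.Edge → ZMod 2 := ∑ v ∈ S, Pi.single (ε v) 1
  let A : Finset Γ.Edge := Finset.univ.filter fun e => a e ≠ 0
  have ha : a = fun e => if e ∈ A then 1 else 0 := by
    funext e
    have : ∀ k : ZMod 2, k = if k ≠ 0 then 1 else 0 := by decide
    simpa [A] using this (a e)
  refine ⟨A, ?_, ?_⟩
  · have hA : A ⊆ S.image ε := by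
      intro e he
      by_contra hn
      refine (Finset.mem_filter.1 he).2 ?_
      simp only [a, Finset.sum_apply]
      refine Finset.sum_eq_zero fun v hv => Pi.single_eq_of_ne (fun h => hn ?_) _
      exact Finset.mem_image.2 ⟨v, hv, h.symm⟩
    refine (Finset.card_le_card hA).trans (Finset.card_image_le.trans (le_of_eq ?_))
    rw [weight, ← Set.ncard_coe_finset]
    congr 1
    ext v; simp [S]
  · have hE : E = ∑ v ∈ S, Γ.single v (E v) := by
      funext w
      simp only [Finset.sum_apply, single, Pi.single_apply, Finset.sum_ite_eq]
      by_cases h : E w = 0 <;> simp [S, h]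
    rw [gaugeEquiv_iff, ← edgeSetError_indicator, ← ha, map_sum]
    nth_rw 1 [hE]
    rw [← Finset.sum_sub_distrib]
    refine sum_mem fun v hv => ?_
    obtain ⟨h1, h2⟩ := hε v (Finset.mem_filter.1 hv).2
    rw [edgeSetError_single, edgeError, ← h2]
    exact Γ.single_sub_single_mem_gaugeGroup (hq _) h1

/-- The star of a vertex: the indicator function of the edges at it, as a functional. -/
noncomputable def star (v : Γ.Vertex) : (Γ.Edge → ZMod 2) →ₗ[ZMod 2] ZMod 2 := by
  classical
  exact ∑ e : Γ.Edge, if Γ.IsEnd v e then LinearMap.proj e else 0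

open Classical in
theorem star_single (v : Γ.Vertex) (e : Γ.Edge) :
    Γ.star v (Pi.single e 1) = if Γ.IsEnd v e then 1 else 0 := by
  rw [star, LinearMap.sum_apply, Finset.sum_eq_single e]
  · split_ifs <;> simp
  · intro e' _ h
    split_ifs <;> simp [h]
  · simp

open Classical in
/-- The product of the letters of the edges at a vertex is a gauge transformation. -/
theorem edgeSetError_star_mem_gaugeGroup {q : Γ.Edge → Γ.Vertex} (hq : Γ.IsQubitChoice q)
    (v : Γ.Vertex) :
    Γ.edgeSetError q (fun e => if Γ.IsEnd v e then 1 else 0) ∈ Γ.gaugeGroup := by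
  obtain ⟨d, rfl⟩ := Γ.exists_vertexOf v
  -- With all three letters placed on the vertex itself the product is trivial; moving each to its
  -- chosen end is a gauge transformation.
  have h0 : ∑ e, (if Γ.IsEnd (Γ.vertexOf d) e then
      Γ.single (Γ.vertexOf d) (Γ.edgeColour e).pauli else 0) = 0 := by
    rw [sum_isEnd, ← single_add, ← single_add]
    simp only [edgeColour_edgeOf, Γ.rot_rot_rot]
    rw [pauli_add_pauli_add_pauli (Γ.colour_rot_rot_ne d) (Γ.colour_rot_ne d).symm
      (Γ.colour_rot_ne _).symm]
    simp [single]
  rw [← sub_zero (Γ.edgeSetError _ _), ← h0, edgeSetError_apply, ← Finset.sum_sub_distrib]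
  refine sum_mem fun e _ => ?_
  split_ifs with h
  · rw [one_smul]
    exact Γ.single_sub_single_mem_gaugeGroup (hq e) h
  · simp

/-- An error that commutes with the operators of all the cycles is a gauge transformation. -/
theorem mem_gaugeGroup_of_commutatorForm {E : Γ.Error}
    (h : ∀ c ∈ Γ.cycleSpace, Γ.commutatorForm (Γ.cycleOp c) E = 0) : E ∈ Γ.gaugeGroup := by
  classical
  obtain ⟨q, hq⟩ := Γ.exists_isQubitChoice
  obtain ⟨A, -, hA⟩ := Γ.exists_edgeSet_gaugeEquiv hq E
  rw [gaugeEquiv_iff, ← edgeSetError_indicator] at hA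
  set a : Γ.Edge → ZMod 2 := fun e => if e ∈ A then 1 else 0 with ha
  -- The common kernel of the stars is the cycle space, and pairing with `a` vanishes there; by
  -- duality `a` is a combination of stars.
  have hker : ⨅ v, LinearMap.ker (Γ.star v) ≤
      LinearMap.ker (Fintype.linearCombination (ZMod 2) a : (Γ.Edge → ZMod 2) →ₗ[ZMod 2] _) := by
    intro c hc
    have h1 := Γ.commutatorForm_cycleOp_of_mem_gaugeGroup hc hA
    rw [map_sub, h c hc, sub_zero, Γ.commutatorForm_cycleOp_edgeSetError hc hq] at h1
    rw [LinearMap.mem_ker, ← h1, Fintype.linearCombination_apply]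
    exact Finset.sum_congr rfl fun e _ => by rw [smul_eq_mul, mul_comm]
  obtain ⟨b, hb⟩ := (Submodule.mem_span_range_iff_exists_fun _).1 (mem_span_of_iInf_ker_le_ker hker)
  have ha' : a = ∑ v, b v • fun e => if Γ.IsEnd v e then (1 : ZMod 2) else 0 := by
    funext e
    have := LinearMap.congr_fun hb (Pi.single e 1)
    rw [LinearMap.sum_apply, Fintype.linearCombination_apply_single, one_smul] at this
    rw [← this, Finset.sum_apply]
    exact Finset.sum_congr rfl fun v _ => by
      rw [LinearMap.smul_apply, star_single, Pi.smul_apply]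
  have : Γ.edgeSetError q a ∈ Γ.gaugeGroup := by
    rw [ha', map_sum]
    exact sum_mem fun v _ => by
      rw [map_smul]
      exact Γ.smul_mem_gaugeGroup _ (Γ.edgeSetError_star_mem_gaugeGroup hq v)
  simpa using sub_mem this hA

theorem faceSyndrome_eq_of_gaugeEquiv {E E' : Γ.Error} (h : Γ.GaugeEquiv E E') :
    Γ.faceSyndrome E = Γ.faceSyndrome E' := by
  funext f
  have := Γ.commutatorForm_cycleOp_of_mem_gaugeGroup (Γ.bdry_mem_cycleSpace f) h
  rwa [map_sub, sub_eq_zero, ← faceSyndrome_apply, ← faceSyndrome_apply] at this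

variable {Γ} {ι : Type*} {σ : ι → Γ.Edge → ZMod 2}

/-- Errors with the same syndrome are equivalent. -/
theorem IsHomologyBasis.gaugeEquiv (hσ : Γ.IsHomologyBasis σ) {E E' : Γ.Error}
    (hf : Γ.faceSyndrome E = Γ.faceSyndrome E') (hc : Γ.cycleSyndrome σ E = Γ.cycleSyndrome σ E') :
    Γ.GaugeEquiv E E' := by
  refine Γ.mem_gaugeGroup_of_commutatorForm fun c hcs => ?_
  -- The commutator is linear in the cycle, so it suffices to test the generators `σ i` and the face
  -- boundaries.
  let L : (Γ.Edge → ZMod 2) →ₗ[ZMod 2] ZMod 2 :=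
    (Γ.commutatorForm.flip (E - E')).comp (Fintype.linearCombination (ZMod 2) Γ.link)
  have hL : ∀ c, L c = Γ.commutatorForm (Γ.cycleOp c) (E - E') := fun c => rfl
  rw [← hL]
  suffices Γ.cycleSpace ≤ LinearMap.ker L from this hcs
  rw [← hσ.span_eq, sup_le_iff, Submodule.span_le, boundarySpace, Submodule.span_le]
  constructor
  · rintro _ ⟨i, rfl⟩
    rw [SetLike.mem_coe, LinearMap.mem_ker, hL, map_sub, sub_eq_zero]
    exact congrFun hc i
  · rintro _ ⟨f, rfl⟩
    rw [SetLike.mem_coe, LinearMap.mem_ker]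
    change L (Γ.bdry f) = 0
    rw [hL, map_sub, sub_eq_zero, ← faceSyndrome_apply, hf, faceSyndrome_apply]

/-! ### The corrections -/

variable (Γ) in
/-- A cycle without `z`-coloured edges is a sum of boundaries of `z`-coloured faces. -/
theorem mem_boundarySpace_of_apply_eq_zero {c : Γ.Edge → ZMod 2} (hc : c ∈ Γ.cycleSpace)
    (hz : ∀ e, Γ.edgeColour e = .z → c e = 0) : c ∈ Γ.boundarySpace := by
  classical
  -- The coefficient of a `z`-face is to be the common value of `c` along its boundary. It is
  -- constant because at each vertex the third edge is `z`-coloured, and the cycle condition equates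
  -- the other two.
  let g : D → ZMod 2 := fun d => if Γ.colour d = .z then c (Γ.edgeOf d) else 0
  have hg : ∀ d, g ((Γ.rot * Γ.opp) d) = g d := by
    intro d
    simp only [g, Equiv.Perm.mul_apply, Γ.colour_face]
    split_ifs with h
    · have h1 := Γ.mem_cycleSpace_iff.1 hc (Γ.opp d)
      rw [hz (Γ.edgeOf (Γ.rot (Γ.rot (Γ.opp d)))) (by
        rw [edgeColour_edgeOf, Γ.rot_rot_rot, Γ.colour_face, h]), add_zero, Γ.edgeOf_opp,
        CharTwo.add_eq_zero] at h1
      exact h1.symm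
    · rfl
  let k : Γ.Face → ZMod 2 := Quotient.lift g fun _ _ h => apply_eq_of_sameCycle _ g hg h
  have hk : ∀ d, k (Γ.faceOf d) = g d := fun _ => rfl
  -- An edge of another colour has a `z`-face on exactly one side; a `z`-coloured edge has none, and
  -- `c` vanishes on it.
  have : c = ∑ f, k f • Γ.bdry f := by
    funext e
    obtain ⟨d, rfl⟩ := Γ.exists_edgeOf e
    simp only [Finset.sum_apply, Pi.smul_apply, bdry_edgeOf, smul_eq_mul, mul_add, mul_ite,
      mul_one, mul_zero, Finset.sum_add_distrib, Finset.sum_ite_eq', Finset.mem_univ, if_true,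
      hk, g, Γ.edgeOf_opp]
    have h1 := Γ.colour_opp_ne d
    have h2 := Γ.colour_rot_ne (Γ.rot d)
    have h3 := Γ.colour_rot_rot_ne d
    have h4 := hz (Γ.edgeOf d)
    rw [Γ.colour_rot d] at h2
    rw [edgeColour_edgeOf] at h4
    revert h1 h2 h3 h4
    generalize c (Γ.edgeOf d) = m
    generalize Γ.colour (Γ.rot (Γ.rot d)) = b
    generalize Γ.colour (Γ.opp d) = b'
    generalize Γ.colour d = b''
    cases b <;> cases b' <;> cases b'' <;> simp
  rw [this]
  exact sum_mem fun f _ => Submodule.smul_mem _ _ (Γ.bdry_mem_boundarySpace f)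

/-- The `i`-th coordinate on the span of the classes of the `σ j` is extended linearly to the
quotient of all chains by boundaries. -/
theorem IsHomologyBasis.exists_dual (hσ : Γ.IsHomologyBasis σ) (i : ι) :
    ∃ ψ : (Γ.Edge → ZMod 2) →ₗ[ZMod 2] ZMod 2, ψ (σ i) = 1 ∧ (∀ j, j ≠ i → ψ (σ j) = 0) ∧
      Γ.boundarySpace ≤ LinearMap.ker ψ := by
  classical
  have hli := hσ.linearIndependent
  obtain ⟨g, hg⟩ := LinearMap.exists_extend ((Finsupp.lapply i).comp hli.repr)
  have key : ∀ j, g (Γ.boundarySpace.mkQ (σ j)) = Finsupp.single j (1 : ZMod 2) i := by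
    intro j
    have hj : Γ.boundarySpace.mkQ (σ j) ∈
        Submodule.span (ZMod 2) (Set.range fun i => Γ.boundarySpace.mkQ (σ i)) :=
      Submodule.subset_span ⟨j, rfl⟩
    have := LinearMap.congr_fun hg ⟨_, hj⟩
    rw [LinearMap.comp_apply, Submodule.subtype_apply] at this
    rw [this, ← hli.repr_eq_single j ⟨_, hj⟩ rfl]
    rfl
  refine ⟨g.comp Γ.boundarySpace.mkQ, ?_, fun j hj => ?_, fun c hc => ?_⟩
  · rw [LinearMap.comp_apply, key, Finsupp.single_eq_same]
  · rw [LinearMap.comp_apply, key, Finsupp.single_eq_of_ne hj.symm]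
  · rw [LinearMap.mem_ker, LinearMap.comp_apply, Submodule.mkQ_apply,
      (Submodule.Quotient.mk_eq_zero _).2 hc, map_zero]

/-- For each of the nonlocal stabilizers there is a `Z` error that anticommutes with it and
commutes with all the other stabilizers. -/
theorem IsHomologyBasis.exists_correction (hσ : Γ.IsHomologyBasis σ) (i : ι) :
    ∃ E : Γ.Error, (∀ v, E v = 0 ∨ E v = Colour.z.pauli) ∧ Γ.faceSyndrome E = 0 ∧
      Γ.cycleSyndrome σ E i = 1 ∧ ∀ j, j ≠ i → Γ.cycleSyndrome σ E j = 0 := by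
  classical
  obtain ⟨ψ, h1, h0, hb⟩ := hσ.exists_dual i
  let φ : {e : Γ.Edge // Γ.edgeColour e = .z} → Γ.cycleSpace →ₗ[ZMod 2] ZMod 2 := fun e =>
    (LinearMap.proj e.1).comp Γ.cycleSpace.subtype
  -- A cycle with no `z`-coloured edge is a boundary, so `ψ` kills it. Restricted to cycles, `ψ` is
  -- therefore a combination of coordinates at `z`-coloured edges, whose letters are all `Z`.
  have hker : ⨅ e, LinearMap.ker (φ e) ≤ LinearMap.ker (ψ.comp Γ.cycleSpace.subtype) := by
    intro c hc
    refine hb (Γ.mem_boundarySpace_of_apply_eq_zero c.2 fun e he => ?_)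
    exact (Submodule.mem_iInf _).1 hc ⟨e, he⟩
  obtain ⟨b, hb'⟩ :=
    (Submodule.mem_span_range_iff_exists_fun _).1 (mem_span_of_iInf_ker_le_ker hker)
  obtain ⟨q, hq⟩ := Γ.exists_isQubitChoice
  let E : Γ.Error := ∑ e, b e • Γ.edgeError q e.1
  have hE : ∀ c ∈ Γ.cycleSpace, Γ.commutatorForm (Γ.cycleOp c) E = ψ c := by
    intro c hc
    have := LinearMap.congr_fun hb' ⟨c, hc⟩
    rw [LinearMap.comp_apply, Submodule.subtype_apply] at this
    rw [← this, map_sum, LinearMap.sum_apply]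
    refine Finset.sum_congr rfl fun e _ => ?_
    rw [map_smul, Γ.commutatorForm_cycleOp_edgeError hc hq]
    rfl
  refine ⟨E, fun v => ?_, ?_, ?_, fun j hj => ?_⟩
  · have : E v ∈ AddSubgroup.zmultiples Colour.z.pauli := by
      simp only [E, Finset.sum_apply]
      refine sum_mem fun e _ => ?_
      rw [Pi.smul_apply]
      refine ZMod.smul_mem ?_ _
      rw [edgeError, single, Pi.single_apply, e.2]
      split_ifs
      · exact AddSubgroup.mem_zmultiples _
      · exact zero_mem _
    obtain ⟨n, hn⟩ := AddSubgroup.mem_zmultiples_iff.1 this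
    rw [← hn, ← Int.cast_smul_eq_zsmul (ZMod 2)]
    generalize (n : ZMod 2) = k
    revert k
    decide
  · funext f
    rw [faceSyndrome_apply, hE _ (Γ.bdry_mem_cycleSpace f)]
    exact hb (Γ.bdry_mem_boundarySpace f)
  · rw [cycleSyndrome_apply, hE _ (hσ.isCycle i), h1]
  · rw [cycleSyndrome_apply, hE _ (hσ.isCycle j), h0 j hj]

end TwoColex

/-! ### Pairings in a metric space -/

/-- In a finite (pseudo)metric space, a pairing of the points of a set extends to a pairing of its
symmetric difference with `{f, g}`, the cost growing by at most the distance of `f` and `g`. -/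
theorem exists_involutive_of_pair {α : Type*} [Fintype α] [DecidableEq α] (d : α → α → ℕ)
    (d_self : ∀ x, d x x = 0) (d_comm : ∀ x y, d x y = d y x)
    (d_triangle : ∀ x y z, d x z ≤ d x y + d y z) {π : α → α} (hπ : Function.Involutive π)
    {f g : α} (hfg : f ≠ g) :
    ∃ π' : α → α, Function.Involutive π' ∧
      (∀ x, π' x ≠ x ↔ ¬ (π x ≠ x ↔ (x = f ∨ x = g))) ∧
      ∑ x, d x (π' x) ≤ ∑ x, d x (π x) + 2 * d f g := by
  -- If `f` and `g` are partners, their pair is simply dissolved.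
  by_cases h : π f = g
  · have hg : π g = f := by rw [← h, hπ]
    have hx : ∀ x, x ≠ f → x ≠ g → π x ≠ f ∧ π x ≠ g := fun x h1 h2 =>
      ⟨fun h' => h2 (by rw [← h, ← h', hπ]), fun h' => h1 (by rw [← hg, ← h', hπ])⟩
    refine ⟨fun x => if x = f ∨ x = g then x else π x, fun x => ?_, fun x => ?_,
      (Finset.sum_le_sum fun x _ => ?_).trans (Nat.le_add_right _ _)⟩
    · by_cases h1 : x = f ∨ x = g
      · simp [h1]
      · have := hx x (fun h => h1 (.inl h)) fun h => h1 (.inr h)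
        simp [h1, this.1, this.2, hπ x]
    · by_cases h1 : x = f ∨ x = g
      · have : π x ≠ x := by rcases h1 with rfl | rfl <;> [exact h ▸ hfg.symm; exact hg ▸ hfg]
        simp [h1, this]
      · simp [h1]
    · dsimp only
      split_ifs
      · simp [d_self]
      · exact le_rfl
  · have h' : π g ≠ f := fun hg => h (by rw [← hg, hπ])
    have hne : π f ≠ π g := fun e => hfg (hπ.injective e)
    have i1 : ∀ x, π x = f ↔ x = π f := fun x => ⟨fun h => by rw [← h, hπ], fun h => by rw [h, hπ]⟩
    have i2 : ∀ x, π x = g ↔ x = π g := fun x => ⟨fun h => by rw [← h, hπ], fun h => by rw [h, hπ]⟩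
    -- The partners of `f` and `g` are paired with each other. A point not yet paired is its own
    -- partner, so this also covers the cases where `f`, `g` or both are fixed by `π`.
    let π' : α → α := fun x =>
      if x = π f then π g else if x = π g then π f else if x = f ∨ x = g then x else π x
    refine ⟨π', fun x => ?_, fun x => ?_, ?_⟩
    · by_cases h1 : x = π f
      · subst h1; simp [π', hne.symm]
      · by_cases h2 : x = π g
        · subst h2; simp [π', hne.symm]
        · by_cases h3 : x = f ∨ x = g
          · simp [π', h1, h2, h3]
          · have h4 : π x ≠ π f := fun e => h3 (.inl (hπ.injective e))
            have h5 : π x ≠ π g := fun e => h3 (.inr (hπ.injective e))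
            simp [π', h1, h2, h3, h4, h5, i1, i2, hπ x]
    · by_cases h1 : x = π f
      · subst h1
        have : (π f = f ∨ π f = g) ↔ π f = f := by simp [h]
        simp only [π', if_true, hπ f, this, ne_eq, hne.symm, not_false_eq_true, true_iff]
        rw [eq_comm]; tauto
      · by_cases h2 : x = π g
        · subst h2
          have : (π g = f ∨ π g = g) ↔ π g = g := by simp [h']
          simp only [π', if_true, hπ g, this, ne_eq, hne, hne.symm, if_false, not_false_eq_true,
            true_iff]
          rw [eq_comm]; tauto
        · by_cases h3 : x = f ∨ x = g
          · have : π x ≠ x := by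
              rcases h3 with rfl | rfl
              exacts [fun e => h1 e.symm, fun e => h2 e.symm]
            simp [π', h1, h2, h3, this]
          · simp [π', h1, h2, h3]
    · have key : ∀ x, d x (π' x) + (if x = f then d f (π f) else 0) +
          (if x = g then d g (π g) else 0) ≤ d x (π x) +
          (if x = π f then d f g + d g (π g) else 0) +
          (if x = π g then d f g + d f (π f) else 0) := by
        intro x
        by_cases h1 : x = π f
        · subst h1
          have t1 := d_triangle (π f) f (π g)
          have t2 := d_triangle f g (π g)
          simp only [π', if_true, hπ f, hne, if_false, h]
          split_ifs with h2
          · rw [h2] at t1 ⊢; simp only [d_self] at t1 ⊢; omega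
          · omega
        · by_cases h2 : x = π g
          · subst h2
            have t1 := d_triangle (π g) g (π f)
            have t2 := d_triangle g f (π f)
            have t3 := d_comm f g
            simp only [π', if_true, hπ g, hne.symm, if_false, h']
            split_ifs with h2
            · rw [h2] at t1 ⊢; simp only [d_self] at t1 ⊢; omega
            · omega
          · simp only [π', h1, h2, if_false]
            by_cases h3 : x = f
            · subst h3; simp [d_self, hfg]
            · by_cases h4 : x = g
              · subst h4; simp [d_self, h3]
              · simp [h3, h4]
      have := Finset.sum_le_sum fun x (_ : x ∈ Finset.univ) => key x
      simp only [Finset.sum_add_distrib, Finset.sum_ite_eq', Finset.mem_univ, if_true] at this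
      omega

namespace TwoColex

variable {D : Type*} (Γ : TwoColex D)

/-! ### Distances in the dual graph -/

variable {Γ} in
theorem IsDualWalk.append {f g h : Γ.Face} {p p' : List Γ.Edge} (hp : Γ.IsDualWalk f p g)
    (hp' : Γ.IsDualWalk g p' h) : Γ.IsDualWalk f (p ++ p') h := by
  induction hp with
  | nil f => exact hp'
  | cons h1 _ ih => exact .cons h1 (ih hp')

theorem isDualWalk_faceOf_opp (d : D) :
    Γ.IsDualWalk (Γ.faceOf d) [Γ.edgeOf d] (Γ.faceOf (Γ.opp d)) :=
  .cons ⟨d, rfl, rfl, rfl⟩ (.nil _)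

/-- Both `rot` and `opp` take a dart to a dart whose face lies across the original dart's edge, so
connectedness of `Γ` passes to the dual graph. -/
theorem exists_isDualWalk (f g : Γ.Face) : ∃ p, Γ.IsDualWalk f p g := by
  obtain ⟨d, rfl⟩ := Γ.exists_faceOf f
  obtain ⟨d', rfl⟩ := Γ.exists_faceOf g
  obtain ⟨k, hk, rfl⟩ := Γ.connected d d'
  induction hk using Subgroup.closure_induction generalizing d with
  | mem x hx =>
    rcases hx with rfl | rfl
    · rw [← faceOf_opp]
      exact ⟨_, Γ.isDualWalk_faceOf_opp d⟩
    · exact ⟨_, Γ.isDualWalk_faceOf_opp d⟩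
  | one => exact ⟨_, .nil _⟩
  | mul x y _ _ hx hy =>
    obtain ⟨p, hp⟩ := hy d
    obtain ⟨p', hp'⟩ := hx (y d)
    exact ⟨_, hp.append hp'⟩
  | inv x _ hx =>
    obtain ⟨p, hp⟩ := hx (x⁻¹ d)
    rw [← Equiv.Perm.mul_apply, mul_inv_cancel, Equiv.Perm.one_apply] at hp
    exact ⟨_, hp.reverse⟩

/-- The infimum defining the distance is attained because some walk exists; otherwise it would be
the default value `0`. -/
theorem exists_isShortestPath (f g : Γ.Face) : ∃ p, Γ.IsShortestPath f p g := by
  obtain ⟨p, hp⟩ := Γ.exists_isDualWalk f g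
  exact Nat.sInf_mem (s := {n | ∃ p, Γ.IsDualWalk f p g ∧ p.length = n}) ⟨_, p, hp, rfl⟩

variable {Γ} in
theorem IsDualWalk.dualDist_le {f g : Γ.Face} {p : List Γ.Edge} (hp : Γ.IsDualWalk f p g) :
    Γ.dualDist f g ≤ p.length := Nat.sInf_le ⟨p, hp, rfl⟩

theorem dualDist_self (f : Γ.Face) : Γ.dualDist f f = 0 :=
  Nat.le_zero.1 (IsDualWalk.nil f).dualDist_le

theorem dualDist_triangle (f g h : Γ.Face) :
    Γ.dualDist f h ≤ Γ.dualDist f g + Γ.dualDist g h := by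
  obtain ⟨p, hp, hl⟩ := Γ.exists_isShortestPath f g
  obtain ⟨p', hp', hl'⟩ := Γ.exists_isShortestPath g h
  rw [← hl, ← hl', ← List.length_append]
  exact (hp.append hp').dualDist_le

theorem dualDist_faceOf_opp_le (d : D) : Γ.dualDist (Γ.faceOf d) (Γ.faceOf (Γ.opp d)) ≤ 1 :=
  (Γ.isDualWalk_faceOf_opp d).dualDist_le

/-! ### Matchings of the odd vertices of an edge set -/

section Matching

variable {Γ} in
theorem existsUnique_mem_edgeSet {s : Γ.Face → ZMod 2}
    {M : (⊤ : SimpleGraph (Γ.Defect s)).Subgraph}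
    (hM : M.IsPerfectMatching) (u : Γ.Defect s) : ∃! m : M.edgeSet, u ∈ m.1 := by
  obtain ⟨w, hw, huniq⟩ := SimpleGraph.Subgraph.isPerfectMatching_iff.1 hM u
  refine ⟨⟨s(u, w), hw⟩, Sym2.mem_mk_left u w, ?_⟩
  rintro ⟨m, hm⟩ hu
  obtain ⟨w', rfl⟩ := Sym2.mem_iff_exists.1 hu
  rw [SimpleGraph.Subgraph.mem_edgeSet] at hm
  simp [huniq w' hm]

open Classical in
theorem odd_dualDegree_insert {A : Finset Γ.Edge} {d : D} (hA : Γ.edgeOf d ∉ A) (f : Γ.Face) :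
    Odd (Γ.dualDegree (insert (Γ.edgeOf d) A) f) ↔
      ¬ (Odd (Γ.dualDegree A f) ↔ (f = Γ.faceOf d ∨ f = Γ.faceOf (Γ.opp d))) := by
  rw [← ZMod.natCast_ne_zero_iff_odd, ← ZMod.natCast_ne_zero_iff_odd, ← sum_bdry, ← sum_bdry,
    Finset.sum_insert hA, ← borders_edgeOf_iff]
  have : Γ.bdry f (Γ.edgeOf d) = if Γ.Borders (Γ.edgeOf d) f then 1 else 0 := rfl
  rw [this]
  generalize ∑ e ∈ A, Γ.bdry f e = k
  by_cases h : Γ.Borders (Γ.edgeOf d) f <;> simp only [h, if_true, if_false] <;> revert k <;> decide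

variable [Finite D]

/-- The vertices of odd degree in an edge set can be paired at a cost of at most its size. -/
theorem exists_involutive_odd_dualDegree (A : Finset Γ.Edge) :
    ∃ π : Γ.Face → Γ.Face, Function.Involutive π ∧ (∀ f, π f ≠ f ↔ Odd (Γ.dualDegree A f)) ∧
      ∑ f, Γ.dualDist f (π f) ≤ 2 * A.card := by
  induction A using Finset.induction_on with
  | empty =>
    refine ⟨id, fun _ => rfl, fun f => ?_, by simp [dualDist_self]⟩
    simp [dualDegree]
  | insert e A he ih =>
    obtain ⟨π, hπ, hs, hc⟩ := ih
    obtain ⟨d, rfl⟩ := Γ.exists_edgeOf e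
    obtain ⟨π', hπ', hs', hc'⟩ := exists_involutive_of_pair Γ.dualDist Γ.dualDist_self
      Γ.dualDist_comm Γ.dualDist_triangle hπ (Γ.faceOf_opp_ne d).symm
    refine ⟨π', hπ', fun f => ?_, ?_⟩
    · rw [hs', hs]
      convert (Γ.odd_dualDegree_insert he f).symm
    · have := Γ.dualDist_faceOf_opp_le d
      rw [Finset.card_insert_of_notMem he]
      omega

variable {Γ} {s : Γ.Face → ZMod 2}

open Classical in
/-- The sum over the edges of a perfect matching that are incident to a given vertex. -/
theorem sum_edgeSet_ite {N : Type*} [AddCommMonoid N]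
    {M : (⊤ : SimpleGraph (Γ.Defect s)).Subgraph} (hM : M.IsPerfectMatching)
    (F : Sym2 (Γ.Defect s) → N) {u w : Γ.Defect s} (huw : M.Adj u w) :
    (∑ m : M.edgeSet, if u ∈ m.1 then F m else 0) = F s(u, w) := by
  rw [Finset.sum_eq_single (⟨s(u, w), huw⟩ : M.edgeSet)]
  · simp
  · intro m _ hm
    exact if_neg fun h => hm ((existsUnique_mem_edgeSet hM u).unique h (Sym2.mem_mk_left u w))
  · simp

noncomputable instance : Fintype (Γ.Defect s) := Fintype.ofFinite _

open Classical in
theorem sum_ite_mem_of_adj {N : Type*} [AddCommMonoid N] {u v : Γ.Defect s} (huv : u ≠ v)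
    (F : Γ.Defect s → N) : (∑ w, if w ∈ s(u, v) then F w else 0) = F u + F v := by
  rw [← Finset.sum_filter, ← Finset.sum_pair huv]
  congr 1
  ext w; simp

/-- Summing over defects meets each matched pair at both ends; this is the form in which the cost of
an involution is measured. -/
theorem two_mul_cost {M : (⊤ : SimpleGraph (Γ.Defect s)).Subgraph} (hM : M.IsPerfectMatching)
    {p : Γ.Defect s → Γ.Defect s} (hp : ∀ u, M.Adj u (p u)) :
    2 * Γ.cost M = ∑ u : Γ.Defect s, Γ.dualDist u (p u) := by
  classical
  have h1 : ∀ u : Γ.Defect s, Γ.dualDist u (p u) =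
      ∑ m : M.edgeSet, if u ∈ m.1 then Γ.pairDist s m else 0 :=
    fun u => (sum_edgeSet_ite hM (Γ.pairDist s) (hp u)).symm
  simp only [h1]
  rw [Finset.sum_comm, cost, Finset.mul_sum]
  refine Finset.sum_congr rfl ?_
  rintro ⟨m, hm⟩ _
  induction m using Sym2.ind with
  | _ u v => rw [sum_ite_mem_of_adj (M.adj_sub hm).ne, two_mul]

theorem exists_isPerfectMatching_cost_le {A : Finset Γ.Edge}
    (hA : ∀ f, s f ≠ 0 ↔ Odd (Γ.dualDegree A f)) :
    ∃ M : (⊤ : SimpleGraph (Γ.Defect s)).Subgraph, M.IsPerfectMatching ∧ Γ.cost M ≤ A.card := by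
  obtain ⟨π, hπ, hs, hc⟩ := Γ.exists_involutive_odd_dualDegree A
  have hsupp : ∀ f, s f ≠ 0 ↔ π f ≠ f := fun f => (hA f).trans (hs f).symm
  -- The points moved by `π` are exactly the defects, so `π` restricts to an involution of them
  -- without fixed points.
  let p : Γ.Defect s → Γ.Defect s := fun u =>
    ⟨π u, by rw [hsupp, hπ]; exact ((hsupp _).1 u.2).symm⟩
  have hpp : ∀ u, p (p u) = u := fun u => Subtype.ext (hπ _)
  have hpn : ∀ u, u ≠ p u := fun u h => (hsupp _).1 u.2 (congrArg Subtype.val h).symm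
  let M : (⊤ : SimpleGraph (Γ.Defect s)).Subgraph :=
    { verts := Set.univ
      Adj := fun u v => p u = v
      adj_sub := by rintro u _ rfl; exact hpn u
      edge_vert := fun _ => Set.mem_univ _
      symm := ⟨by rintro u _ rfl; exact hpp u⟩ }
  have hM : M.IsPerfectMatching := SimpleGraph.Subgraph.isPerfectMatching_iff.2 fun u =>
    ⟨p u, rfl, fun _ h => Eq.symm h⟩
  refine ⟨M, hM, ?_⟩
  have h2 := two_mul_cost hM (p := p) fun u => rfl
  have h3 : ∑ u : Γ.Defect s, Γ.dualDist u (p u) ≤ ∑ f, Γ.dualDist f (π f) := by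
    have := Finset.sum_map (Finset.univ : Finset (Γ.Defect s)) (Function.Embedding.subtype _)
      fun f => Γ.dualDist f (π f)
    exact this.symm.trans_le (Finset.sum_le_sum_of_subset (Finset.subset_univ _))
  omega

end Matching

end TwoColex

namespace TwoColex

variable {D : Type*} {Γ : TwoColex D}

/-! ### Runs of the decoder -/

theorem weight_zero : Γ.weight 0 = 0 := by simp [weight]

variable [Finite D]

theorem weight_add_le (E E' : Γ.Error) : Γ.weight (E + E') ≤ Γ.weight E + Γ.weight E' := by
  refine (Set.ncard_le_ncard (fun v hv => ?_) (Set.toFinite _)).trans (Set.ncard_union_le _ _)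
  by_contra h
  simp only [Set.mem_union, Set.mem_ofPred_eq, not_or, not_not] at h hv
  exact hv (by rw [Pi.add_apply, h.1, h.2, add_zero])

theorem weight_single_le (v : Γ.Vertex) (P : Pauli) : Γ.weight (Γ.single v P) ≤ 1 := by
  refine (Set.ncard_le_ncard (t := {v}) (fun w hw => ?_) (Set.toFinite _)).trans
    (Set.ncard_singleton v).le
  by_contra h
  exact hw (Pi.single_eq_of_ne (M := fun _ => Pauli) h P)

theorem weight_sum_edgeError_le (q : Γ.Edge → Γ.Vertex) (p : List Γ.Edge) :
    Γ.weight (p.map (Γ.edgeError q)).sum ≤ p.length := by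
  induction p with
  | nil => simp [weight_zero]
  | cons e p ih =>
    rw [List.map_cons, List.sum_cons, List.length_cons, add_comm p.length]
    exact (weight_add_le _ _).trans (add_le_add (weight_single_le _ _) ih)

-- The contributions of the intermediate faces telescope; for a closed walk the two ends cancel as
-- well.
open Classical in
theorem IsDualWalk.faceSyndrome {q : Γ.Edge → Γ.Vertex} (hq : Γ.IsQubitChoice q) {f g : Γ.Face}
    {p : List Γ.Edge} (hp : Γ.IsDualWalk f p g) (h : Γ.Face) :
    Γ.faceSyndrome (p.map (Γ.edgeError q)).sum h =
      (if h = f then 1 else 0) + (if h = g then 1 else 0) := by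
  induction hp with
  | nil f => simp [faceSyndrome_apply, CharTwo.add_self_eq_zero]
  | @cons e f g k p he _ ih =>
    obtain ⟨d, rfl, rfl, rfl⟩ := he
    rw [List.map_cons, List.sum_cons, faceSyndrome_apply, map_add, ← faceSyndrome_apply,
      ← faceSyndrome_apply, ih, Γ.faceSyndrome_edgeError hq, bdry_edgeOf, add_assoc,
      ← add_assoc (if h = Γ.faceOf (Γ.opp d) then (1 : ZMod 2) else 0),
      CharTwo.add_self_eq_zero, zero_add]

namespace DecoderRun

variable {ι : Type*} {σ : ι → Γ.Edge → ZMod 2} {s : Γ.Face → ZMod 2} {t : ι → ZMod 2}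

theorem faceSyndrome_matchingError (R : Γ.DecoderRun σ s t) :
    Γ.faceSyndrome R.matchingError = s := by
  classical
  funext f
  have hpath : ∀ m : R.matching.edgeSet,
      Γ.faceSyndrome ((R.path m).map (Γ.edgeError R.qubit)).sum f =
        ∑ w : Γ.Defect s, if w ∈ m.1 then (if f = w then 1 else 0) else 0 := by
    intro m
    obtain ⟨u, v, hm, hp, -⟩ := R.isShortest m
    have huv : u ≠ v := by
      have := m.2
      rw [hm] at this
      exact (R.matching.adj_sub this).ne
    rw [hp.faceSyndrome R.isQubitChoice, hm, sum_ite_mem_of_adj huv]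
  have hw : ∀ w : Γ.Defect s, (∑ m : R.matching.edgeSet,
      if w ∈ m.1 then (if f = w then (1 : ZMod 2) else 0) else 0) = if f = w then 1 else 0 := by
    intro w
    obtain ⟨w', hw', -⟩ := SimpleGraph.Subgraph.isPerfectMatching_iff.1 R.isPerfect w
    exact sum_edgeSet_ite R.isPerfect (fun _ => if f = w then (1 : ZMod 2) else 0) hw'
  rw [matchingError, faceSyndrome_apply, map_sum]
  simp only [← faceSyndrome_apply, hpath]
  -- After the exchange each defect is counted once, since a perfect matching has exactly one edge
  -- at it.
  rw [Finset.sum_comm]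
  simp only [hw]
  by_cases hf : s f = 0
  · rw [hf]
    refine Finset.sum_eq_zero fun w _ => if_neg fun h : f = w => w.2 ?_
    rw [← h, hf]
  · rw [Finset.sum_eq_single (⟨f, hf⟩ : Γ.Defect s)]
    · exact (if_pos rfl).trans (Fin.eq_one_of_ne_zero (s f) hf).symm
    · exact fun w _ hw => if_neg fun h => hw (Subtype.ext h.symm)
    · simp

/-- Only subadditivity is used here: the letters of different path edges may meet on one qubit. -/
theorem weight_matchingError_le_cost (R : Γ.DecoderRun σ s t) :
    Γ.weight R.matchingError ≤ Γ.cost R.matching := by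
  have hle : ∀ S : Finset R.matching.edgeSet,
      Γ.weight (∑ m ∈ S, ((R.path m).map (Γ.edgeError R.qubit)).sum) ≤
        ∑ m ∈ S, Γ.pairDist s m := by
    intro S
    classical
    induction S using Finset.induction_on with
    | empty => simp [weight_zero]
    | insert m S hm ih =>
      rw [Finset.sum_insert hm, Finset.sum_insert hm]
      refine (weight_add_le _ _).trans (add_le_add ((weight_sum_edgeError_le _ _).trans ?_) ih)
      obtain ⟨u, v, h, hp⟩ := R.isShortest m
      rw [h, hp.2]
      rfl
  exact hle Finset.univ

theorem cost_le_card (R : Γ.DecoderRun σ s t) {A : Finset Γ.Edge}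
    (hA : ∀ f, s f ≠ 0 ↔ Odd (Γ.dualDegree A f)) : Γ.cost R.matching ≤ A.card := by
  obtain ⟨M, hM, hc⟩ := exists_isPerfectMatching_cost_le hA
  exact (R.isMinimum M hM).trans hc

theorem cost_le_weight (R : Γ.DecoderRun σ s t) {E : Γ.Error} (hE : Γ.faceSyndrome E = s) :
    Γ.cost R.matching ≤ Γ.weight E := by
  obtain ⟨A, hA, hg⟩ := Γ.exists_edgeSet_gaugeEquiv R.isQubitChoice E
  refine (R.cost_le_card fun f => ?_).trans hA
  rw [← Γ.faceSyndrome_ne_zero_iff_odd_dualDegree R.isQubitChoice,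
    Γ.faceSyndrome_eq_of_gaugeEquiv hg, hE]

/-- Overlaps cannot save weight: the matching error itself has face syndrome `s`, so the lower bound
applies to it. -/
theorem weight_matchingError (R : Γ.DecoderRun σ s t) :
    Γ.weight R.matchingError = Γ.cost R.matching :=
  R.weight_matchingError_le_cost.antisymm (R.cost_le_weight R.faceSyndrome_matchingError)

theorem faceSyndrome_output [Fintype ι] (R : Γ.DecoderRun σ s t) :
    Γ.faceSyndrome R.output = s := by
  funext f
  rw [output, faceSyndrome_apply, map_add, map_sum, ← faceSyndrome_apply,
    R.faceSyndrome_matchingError, Finset.sum_eq_zero, add_zero]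
  intro i _
  rw [map_smul, ← faceSyndrome_apply, R.correction_face, Pi.zero_apply, smul_zero]

theorem cycleSyndrome_output [Fintype ι] (R : Γ.DecoderRun σ s t) :
    Γ.cycleSyndrome σ R.output = t := by
  funext j
  rw [output, cycleSyndrome_apply, map_add, map_sum, Finset.sum_eq_single j, map_smul]
  · simp only [← cycleSyndrome_apply]
    rw [R.correction_self, residual, smul_eq_mul, mul_one, add_comm (t j), ← add_assoc,
      CharTwo.add_self_eq_zero, zero_add]
  · intro i _ hij
    rw [map_smul, ← cycleSyndrome_apply, R.correction_other i j hij.symm, smul_zero]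
  · simp

theorem output_eq_matchingError [Fintype ι] (R : Γ.DecoderRun σ s t) (h : R.residual = 0) :
    R.output = R.matchingError := by
  simp [output, h]

/-- All the objects that the decoder has to find exist. -/
theorem nonempty (hσ : Γ.IsHomologyBasis σ) {E : Γ.Error} (hE : Γ.faceSyndrome E = s) :
    Nonempty (Γ.DecoderRun σ s t) := by
  obtain ⟨q, hq⟩ := Γ.exists_isQubitChoice
  obtain ⟨A, -, hg⟩ := Γ.exists_edgeSet_gaugeEquiv hq E
  obtain ⟨M₀, hM₀, -⟩ := exists_isPerfectMatching_cost_le (s := s) (A := A) fun f => by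
    rw [← Γ.faceSyndrome_ne_zero_iff_odd_dualDegree hq, Γ.faceSyndrome_eq_of_gaugeEquiv hg, hE]
  obtain ⟨M, hM, hmin⟩ := exists_minimalFor_of_wellFoundedLT
    (fun M : (⊤ : SimpleGraph (Γ.Defect s)).Subgraph => M.IsPerfectMatching) Γ.cost ⟨M₀, hM₀⟩
  have hpath : ∀ m : M.edgeSet, ∃ p, ∃ u v : Γ.Defect s, m.1 = s(u, v) ∧
      Γ.IsShortestPath u p v := by
    rintro ⟨m, hm⟩
    induction m using Sym2.ind with
    | _ u v =>
      obtain ⟨p, hp⟩ := Γ.exists_isShortestPath u v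
      exact ⟨p, u, v, rfl, hp⟩
  choose p hp using hpath
  choose C h1 h2 h3 h4 using hσ.exists_correction
  exact ⟨{
    matching := M
    isPerfect := hM
    isMinimum := fun M' hM' => (le_total _ _).elim id fun h => hmin hM' h
    path := p
    isShortest := hp
    qubit := q
    isQubitChoice := hq
    correction := C
    correction_isZ := h1
    correction_face := h2
    correction_self := h3
    correction_other := h4 }⟩

end DecoderRun

end TwoColex

/-! ### The decoding theorem -/

theorem mainTheorem2 {D : Type*} [Finite D] [Nonempty D] (Γ : TwoColex D)
    (σ : Fin (2 * Γ.genus) → Γ.Edge → ZMod 2) (hσ : Γ.IsHomologyBasis σ) :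
    -- the syndrome of an edge set of the dual graph sits at its vertices of odd degree
    (∀ (q : Γ.Edge → Γ.Vertex), Γ.IsQubitChoice q → ∀ (A : Finset Γ.Edge) (f : Γ.Face),
      Γ.faceSyndrome (∑ e ∈ A, Γ.edgeError q e) f ≠ 0 ↔ Odd (Γ.dualDegree A f)) ∧
    -- every error is equivalent to the error of an edge set that is not larger
    (∀ (q : Γ.Edge → Γ.Vertex), Γ.IsQubitChoice q → ∀ E : Γ.Error, ∃ A : Finset Γ.Edge,
      A.card ≤ Γ.weight E ∧ Γ.GaugeEquiv (∑ e ∈ A, Γ.edgeError q e) E) ∧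
    -- the decoder, on the syndrome `(s, t)` of an arbitrary error
    ∀ (s : Γ.Face → ZMod 2) (t : Fin (2 * Γ.genus) → ZMod 2),
      (∃ E₀ : Γ.Error, Γ.faceSyndrome E₀ = s ∧ Γ.cycleSyndrome σ E₀ = t) →
      -- all the objects that the decoder has to find exist
      Nonempty (Γ.DecoderRun σ s t) ∧
      ∀ R : Γ.DecoderRun σ s t,
        -- the matching yields a minimum-weight error with the given syndrome on the faces
        (Γ.faceSyndrome R.matchingError = s ∧
          Γ.weight R.matchingError = Γ.cost R.matching ∧
          (∀ E : Γ.Error, Γ.faceSyndrome E = s → Γ.weight R.matchingError ≤ Γ.weight E) ∧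
          (∀ A : Finset Γ.Edge, (∀ f, s f ≠ 0 ↔ Odd (Γ.dualDegree A f)) →
            Γ.cost R.matching ≤ A.card)) ∧
        -- the returned error has the whole given syndrome
        (Γ.faceSyndrome R.output = s ∧ Γ.cycleSyndrome σ R.output = t) ∧
        -- modulo the gauge group it is the minimum-weight error with that syndrome
        (∃ E : Γ.Error, Γ.faceSyndrome E = s ∧ Γ.cycleSyndrome σ E = t ∧
          (∀ E' : Γ.Error, Γ.faceSyndrome E' = s → Γ.cycleSyndrome σ E' = t →
            Γ.weight E ≤ Γ.weight E') ∧
          Γ.GaugeEquiv R.output E) ∧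
        (∀ E : Γ.Error, Γ.faceSyndrome E = s → Γ.cycleSyndrome σ E = t →
          Γ.GaugeEquiv R.output E) ∧
        -- and of minimum weight itself if no nonlocal syndrome was left after the matching
        (R.residual = 0 → ∀ E : Γ.Error, Γ.faceSyndrome E = s → Γ.cycleSyndrome σ E = t →
          Γ.weight R.output ≤ Γ.weight E) := by

  refine ⟨fun q hq A f => Γ.faceSyndrome_ne_zero_iff_odd_dualDegree hq A f,
    fun q hq E => Γ.exists_edgeSet_gaugeEquiv hq E, ?_⟩
  rintro s t ⟨E₀, hs₀, ht₀⟩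
  refine ⟨TwoColex.DecoderRun.nonempty hσ hs₀, fun R => ?_⟩
  have hequiv : ∀ E : Γ.Error, Γ.faceSyndrome E = s → Γ.cycleSyndrome σ E = t →
      Γ.GaugeEquiv R.output E := fun E hs ht =>
    hσ.gaugeEquiv (R.faceSyndrome_output.trans hs.symm) (R.cycleSyndrome_output.trans ht.symm)
  have hmin : ∀ E : Γ.Error, Γ.faceSyndrome E = s → Γ.weight R.matchingError ≤ Γ.weight E :=
    fun E hE => R.weight_matchingError_le_cost.trans (R.cost_le_weight hE)
  refine ⟨⟨R.faceSyndrome_matchingError, R.weight_matchingError, hmin, fun A => R.cost_le_card⟩,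
    ⟨R.faceSyndrome_output, R.cycleSyndrome_output⟩, ?_, hequiv, fun h E hs _ => ?_⟩
  · obtain ⟨E, ⟨hs, ht⟩, hE⟩ := exists_minimalFor_of_wellFoundedLT
      (fun E : Γ.Error => Γ.faceSyndrome E = s ∧ Γ.cycleSyndrome σ E = t) Γ.weight ⟨E₀, hs₀, ht₀⟩
    exact ⟨E, hs, ht, fun E' hs' ht' => (le_total _ _).elim id fun h => hE ⟨hs', ht'⟩ h,
      hequiv E hs ht⟩
  -- Without residual the output is the matching error, which is minimal even among all errors with
  -- face syndrome `s`.
  · rw [R.output_eq_matchingError h]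
    exact hmin E hs
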